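/- Let $m,n\ge 0$ be integers, $\overline m=\{1,\dots,m\}$, let $A:\overline m\to\mathbb R^n$ be an arbitrary map (a labelled point configuration; repeated points are allowed), and let $F:2^{\overline m}\to\mathbb R\cup\{-\infty\}$ be a function which is finite on $\emptyset$ and on all subsets of $\overline m$ with more than $n$ elements. For a finite set $S\subset\mathbb R^n$ let $\operatorname{Vol}S$ be the lattice volume of its convex hull, i.e. $n!$ times its $n$-dimensional Lebesgue measure. The *basecondary function* $\mathscr B_F:\mathbb R^{\overline m}\to\mathbb R$ is $$\mathscr B_F(\lambda)=\sum_{\gamma}\gamma(0)\cdot\bigl(F\{\lambda-\gamma\circ A\ge 0\}-F\{\lambda-\gamma\circ A>0\}\bigr)\cdot\operatorname{Vol}A\{\lambda-\gamma\circ A=\max\},$$ where the sum is over all affine linear functions $\gamma:\mathbb R^n\to\mathbb R$ (all but finitely many terms vanish; a term whose volume factor is zero is zero), $\{\cdot\}$ denotes the set of labels in $\overline m$ satisfying the given condition, and $\{\lambda-\gamma\circ A=\max\}$ is the set of labels at which $\lambda-\gamma\circ A$ attains its maximum over $\overline m$. A *triangulation* of $A$ is a set $T$ of $(n+1)$-element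 subsets $\sigma\subset\overline m$ such that the points $A(i)$, $i\in\sigma$, are affinely independent for every $\sigma\in T$, the simplices $\operatorname{conv}A(\sigma)$, $\sigma\in T$, cover $\operatorname{conv}A(\overline m)$, and $\operatorname{conv}A(\sigma)\cap\operatorname{conv}A(\tau)=\operatorname{conv}A(\sigma\cap\tau)$ for all $\sigma,\tau\in T$. The *secondary polytope* $S_A\subset\mathbb R^{\overline m}$ is the convex hull of the vectors $\varphi_T$, $\varphi_T(i)=\sum_{\sigma\in T,\ i\in\sigma}\operatorname{Vol}A(\sigma)$, over all triangulations $T$ of $A$, and its support function is $h_A(\lambda)=\sup_{x\in S_A}\sum_{i}\lambda_i x_i$. (If $m\ge 1$ and $A(\overline m)$ lies in an affine hyperplane, there are no triangulations; then $\mathscr B_F=0$, and $h_A$ is set to be $0$.) **Theorem.** Assume that $F$ is submodular for sets of size at least $n$, i.e. $$F(I\cap J)+F(I\cup J)\le F(I)+F(J)\quad\text{for all } I,J\subset\overline m\text{ with }|I\cap J|\ge n .$$ Then there is a real number $c_0$ such that for every $c\ge c_0$ the function $\mathscr B_F+c\,h_A$ is convex on $\mathbb R^{\overline m}$. -/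

import Mathlib

namespace Basecondary

noncomputable section

/-- The `n`-dimensional lattice volume of the convex hull of `S`: Lebesgue measure multiplied by
`n !`, so that the standard simplex has volume one. -/
def latticeVol {n : ℕ} (S : Set (Fin n → ℝ)) : ℝ :=
  (n.factorial : ℝ) * MeasureTheory.volume.real (convexHull ℝ S)

/-- The set of labels at which `l - γ ∘ A` attains its maximum over all labels. -/
def maxLocus {m n : ℕ} (A : Fin m → Fin n → ℝ) (l : Fin m → ℝ)
    (γ : (Fin n → ℝ) →ᵃ[ℝ] ℝ) : Set (Fin m) :=
  {i | ∀ j, l j - γ (A j) ≤ l i - γ (A i)}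

/-- The set of labels at which `l - γ ∘ A` is nonnegative. -/
def nonnegLocus {m n : ℕ} (A : Fin m → Fin n → ℝ) (l : Fin m → ℝ)
    (γ : (Fin n → ℝ) →ᵃ[ℝ] ℝ) : Finset (Fin m) :=
  Finset.univ.filter fun i => 0 ≤ l i - γ (A i)

/-- The set of labels at which `l - γ ∘ A` is positive. -/
def posLocus {m n : ℕ} (A : Fin m → Fin n → ℝ) (l : Fin m → ℝ)
    (γ : (Fin n → ℝ) →ᵃ[ℝ] ℝ) : Finset (Fin m) :=
  Finset.univ.filter fun i => 0 < l i - γ (A i)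

/-- The contribution of the affine function `γ` to the basecondary function at `l`. The set
function may take the value `⊥` (that is, `-∞`); when it is finite on the empty set and on all sets
with more than `n` elements, every contribution with a nonzero volume factor only involves finite
values, so that the default value of `WithBot.unbotD` plays no role. -/
def basecondaryTerm {m n : ℕ} (A : Fin m → Fin n → ℝ) (F : Finset (Fin m) → WithBot ℝ)
    (l : Fin m → ℝ) (γ : (Fin n → ℝ) →ᵃ[ℝ] ℝ) : ℝ :=
  γ 0 * ((F (nonnegLocus A l γ)).unbotD 0 - (F (posLocus A l γ)).unbotD 0) *
    latticeVol (A '' maxLocus A l γ)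

/-- The basecondary function. The sum runs over all affine functions `γ`; only finitely many terms
are nonzero, see `finite_support_basecondaryTerm`. -/
def basecondary {m n : ℕ} (A : Fin m → Fin n → ℝ) (F : Finset (Fin m) → WithBot ℝ)
    (l : Fin m → ℝ) : ℝ :=
  ∑ᶠ γ : (Fin n → ℝ) →ᵃ[ℝ] ℝ, basecondaryTerm A F l γ

theorem affineSpan_eq_top_of_latticeVol_ne_zero {n : ℕ} {S : Set (Fin n → ℝ)}
    (h : latticeVol S ≠ 0) : affineSpan ℝ S = ⊤ := by
  by_contra hne
  apply h
  have h0 : MeasureTheory.volume (convexHull ℝ S) = 0 :=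
    MeasureTheory.measure_mono_null (convexHull_subset_affineSpan S)
      (MeasureTheory.Measure.addHaar_affineSubspace _ _ hne)
  simp [latticeVol, MeasureTheory.measureReal_def, h0]

theorem finite_support_basecondaryTerm {m n : ℕ} (A : Fin m → Fin n → ℝ)
    (F : Finset (Fin m) → WithBot ℝ) (l : Fin m → ℝ) :
    (Function.support (basecondaryTerm A F l)).Finite := by
  classical
  have key : ∀ γ ∈ Function.support (basecondaryTerm A F l),
      affineSpan ℝ (A '' maxLocus A l γ) = ⊤ ∧ ∃ i, l i = γ (A i) := by
    intro γ hγ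
    rw [Function.mem_support, basecondaryTerm] at hγ
    refine ⟨affineSpan_eq_top_of_latticeVol_ne_zero (right_ne_zero_of_mul hγ), ?_⟩
    by_contra! hno
    apply right_ne_zero_of_mul (left_ne_zero_of_mul hγ)
    have : nonnegLocus A l γ = posLocus A l γ := by
      ext i
      simp only [nonnegLocus, posLocus, Finset.mem_filter, Finset.mem_univ, true_and]
      exact ⟨fun h => lt_of_le_of_ne h (fun h' => hno i (by linarith)), le_of_lt⟩
    rw [this, sub_self]
  refine Set.Finite.of_finite_image (f := fun γ => (maxLocus A l γ, {i | l i = γ (A i)})) (Set.toFinite _) ?_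
  intro γ hγ δ hδ heq
  simp only [Prod.mk.injEq] at heq
  obtain ⟨hS, hI⟩ := heq
  have hspan := (key γ hγ).1
  have hne : (maxLocus A l γ).Nonempty := by
    rw [← Set.image_nonempty (f := A), ← affineSpan_nonempty ℝ, hspan]
    exact ⟨0, trivial⟩
  obtain ⟨k, hk⟩ := hne
  have hconst : Set.EqOn γ
      (δ + AffineMap.const ℝ (Fin n → ℝ) (γ (A k) - δ (A k)) : (Fin n → ℝ) →ᵃ[ℝ] ℝ) (A '' maxLocus A l γ) := by
    rintro _ ⟨j, hj, rfl⟩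
    have h1 := hk j
    have h2 := hj k
    rw [hS] at hk hj
    have h3 := hk j
    have h4 := hj k
    simp only [AffineMap.coe_add, Pi.add_apply, AffineMap.const_apply]
    linarith
  obtain ⟨-, i, h6⟩ := key γ hγ
  have h7 : l i = δ (A i) := by
    have : i ∈ {i | l i = γ (A i)} := h6
    rwa [hI] at this
  have hγδ := AffineMap.ext_on hspan hconst
  have h5 := congrArg (fun f => f (A i)) hγδ
  simp only [AffineMap.coe_add, Pi.add_apply, AffineMap.const_apply] at h5
  have h8 : γ (A k) - δ (A k) = 0 := by linarith
  rw [hγδ, h8]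
  ext x
  simp

/-- `T` is (the set of maximal simplices of) a triangulation of the labelled point configuration
`A` in dimension `n`: its members are label sets of nondegenerate `n`-simplices, these cover the
convex hull of the configuration, and any two of them meet in the face spanned by their common
labels. -/
def IsTriangulation {m n : ℕ} (A : Fin m → Fin n → ℝ) (T : Finset (Finset (Fin m))) : Prop :=
  (∀ σ ∈ T, σ.card = n + 1 ∧ AffineIndependent ℝ (fun i : σ => A i)) ∧
  (⋃ σ ∈ T, convexHull ℝ (A '' (σ : Set (Fin m)))) = convexHull ℝ (Set.range A) ∧
  ∀ σ ∈ T, ∀ τ ∈ T,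
    convexHull ℝ (A '' (σ : Set (Fin m))) ∩ convexHull ℝ (A '' (τ : Set (Fin m))) =
      convexHull ℝ (A '' ((σ : Set (Fin m)) ∩ (τ : Set (Fin m))))

/-- The Gelfand–Kapranov–Zelevinsky vector of a triangulation: its coordinate at `i` is the total
lattice volume of the maximal simplices having `i` as a vertex. -/
def gkzVector {m n : ℕ} (A : Fin m → Fin n → ℝ) (T : Finset (Finset (Fin m))) : Fin m → ℝ :=
  fun i => ∑ σ ∈ T.filter (fun σ => i ∈ σ), latticeVol (A '' (σ : Set (Fin m)))

/-- The secondary polytope of the labelled point configuration `A`. -/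
def secondaryPolytope {m n : ℕ} (A : Fin m → Fin n → ℝ) : Set (Fin m → ℝ) :=
  convexHull ℝ {φ | ∃ T, IsTriangulation A T ∧ gkzVector A T = φ}

/-- The support function of a bounded set `P`, with respect to the standard pairing. -/
def supportFunction {m : ℕ} (P : Set (Fin m → ℝ)) (l : Fin m → ℝ) : ℝ :=
  sSup ((fun x : Fin m → ℝ => ∑ i, l i * x i) '' P)

end

end Basecondary

/-! The support function `h_A` is the maximum of finitely many linear functionals, one for each
triangulation `T`, namely the pairing with its GKZ vector. If `T` attains the maximum at `l`, then
the interpolation of `l` over every simplex of `T` dominates `l` at all labels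
(`IsTriangulation.admissible_of_le`), so `T` refines the regular subdivision induced by `l`. An
affine function with nonzero volume factor is then, up to a constant, the interpolation of `l` over
some simplices of `T`, and the sum over `γ` becomes a sum over `σ ∈ T` and over vertical translates.

For one simplex `σ`, let `x i ≤ 0` be `l i` minus the interpolation at `A i`. Summation over the
levels of `x` gives a linear term plus the sum of `x i` times the marginal value of `F` at `i`,
along an order sorting `x` decreasingly: a Lovász extension. Since `x` vanishes on `σ`, only sets
containing `σ` matter; they have more than `n` elements, so `F` is finite and submodular on them. By
Edmonds' greedy argument (`sum_mul_greedy_le`) the sorting order is optimal among all orders. Hence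
the basecondary function is a maximum of linear functionals on the cone of `T`
(`IsTriangulation.basecondary_isMax`).

Convexity can thus fail only between different cones, and a multiple of `h_A` repairs it
(`exists_convexOn_add_mul`). A linear piece from another cone exceeds the basecondary function by at
most a constant times the gap of `h_A`: where the gap vanishes, that piece also belongs to a
maximizing triangulation, so the excess is nonpositive, and Farkas' lemma supplies the constant. -/

namespace Basecondary

/-! ### Farkas' lemma and convexity of piecewise linear functions -/

/-- **Farkas' lemma**: a linear functional that is nonnegative wherever finitely many given linear
functionals are nonnegative is a nonnegative combination of them. -/
theorem exists_nonneg_combination {ι V : Type*} [AddCommGroup V] [Module ℝ V] [DecidableEq ι]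
    (s : Finset ι) (p : ι → V →ₗ[ℝ] ℝ) (w : V →ₗ[ℝ] ℝ)
    (h : ∀ x, (∀ i ∈ s, 0 ≤ p i x) → 0 ≤ w x) :
    ∃ a : ι → ℝ, (∀ i, 0 ≤ a i) ∧ w = ∑ i ∈ s, a i • p i := by
  induction s using Finset.induction_on generalizing p w with
  | empty =>
    refine ⟨0, fun _ => le_rfl, ?_⟩
    ext x
    have h1 := h x (by simp)
    have h2 := h (-x) (by simp)
    rw [map_neg] at h2
    simpa using le_antisymm (by linarith) h1
  | insert k s hk ih =>
    by_cases hs : ∀ x, (∀ i ∈ s, 0 ≤ p i x) → 0 ≤ w x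
    · obtain ⟨a, ha, hw⟩ := ih p w hs
      refine ⟨fun i => if i = k then 0 else a i, fun i => by dsimp only; split_ifs <;> simp [ha], ?_⟩
      rw [Finset.sum_insert hk, hw]
      simp only [if_true, zero_smul, zero_add]
      refine Finset.sum_congr rfl fun i hi => ?_
      rw [if_neg (ne_of_mem_of_not_mem hi hk)]
    · push Not at hs
      obtain ⟨x, hx, hwx⟩ := hs
      have hkx : p k x < 0 := by
        by_contra! hkx
        exact hwx.not_ge (h x (by simpa [hkx] using hx))
      -- With `p k y = -1`, the map `z ↦ z + p k z • y` projects onto the kernel of `p k`. The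
      -- induction hypothesis is applied to all functionals composed with this projection; undoing
      -- it determines the coefficient of `p k`.
      set y : V := (-(p k x))⁻¹ • x with hy
      have hpos : 0 < (-(p k x))⁻¹ := inv_pos.2 (neg_pos.2 hkx)
      have hky : p k y = -1 := by
        rw [hy, map_smul, smul_eq_mul, inv_neg, neg_mul, inv_mul_cancel₀ hkx.ne]
      have hpy : ∀ i ∈ s, 0 ≤ p i y := fun i hi => by
        rw [hy, map_smul]
        exact mul_nonneg hpos.le (hx i hi)
      have hwy : w y < 0 := by
        rw [hy, map_smul]
        exact mul_neg_of_pos_of_neg hpos hwx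
      obtain ⟨a, ha, hw⟩ := ih (fun i => p i + p i y • p k) (w + w y • p k) fun z hz => by
        have := h (z + p k z • y) fun i hi => by
          rcases Finset.mem_insert.1 hi with rfl | hi
          · simp [hky]
          · have := hz i hi
            simp only [LinearMap.add_apply, LinearMap.smul_apply, smul_eq_mul] at this
            simp only [map_add, map_smul, smul_eq_mul]
            linarith
        simp only [map_add, map_smul, smul_eq_mul] at this
        simp only [LinearMap.add_apply, LinearMap.smul_apply, smul_eq_mul]
        linarith
      have hnn : 0 ≤ ∑ i ∈ s, a i * p i y := Finset.sum_nonneg fun i hi => mul_nonneg (ha i) (hpy i hi)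
      refine ⟨fun i => if i = k then ∑ i ∈ s, a i * p i y - w y else a i, fun i => ?_, ?_⟩
      · dsimp only
        split_ifs
        · linarith
        · exact ha i
      · rw [Finset.sum_insert hk]
        simp only [if_true]
        have : ∑ i ∈ s, (if i = k then ∑ i ∈ s, a i * p i y - w y else a i) • p i =
            ∑ i ∈ s, a i • p i := Finset.sum_congr rfl fun i hi => by
          rw [if_neg (ne_of_mem_of_not_mem hi hk)]
        rw [this]
        ext z
        have hz := congrArg (fun f => f z) hw
        simp only [LinearMap.add_apply, LinearMap.smul_apply, smul_eq_mul, LinearMap.sum_apply,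
          mul_add, Finset.sum_add_distrib] at hz ⊢
        have : ∑ i ∈ s, a i * (p i y * p k z) = (∑ i ∈ s, a i * p i y) * p k z := by
          rw [Finset.sum_mul]
          exact Finset.sum_congr rfl fun i _ => by ring
        rw [this] at hz
        linarith

/-- On a polyhedral cone on which `u` is nonnegative, a functional `v` which is nonpositive where `u`
vanishes is bounded by a multiple of `u`. -/
theorem exists_le_mul_of_polyhedral {ι V : Type*} [Finite ι] [AddCommGroup V] [Module ℝ V]
    (p : ι → V →ₗ[ℝ] ℝ) (u v : V →ₗ[ℝ] ℝ)
    (h : ∀ x, (∀ i, 0 ≤ p i x) → u x ≤ 0 → v x ≤ 0) :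
    ∃ b : ℝ, 0 ≤ b ∧ ∀ x, (∀ i, 0 ≤ p i x) → v x ≤ b * u x := by
  classical
  have := Fintype.ofFinite ι
  -- The constraint `-u ≥ 0` is added as the index `none`; its Farkas coefficient is the required
  -- `b`.
  obtain ⟨a, ha, hw⟩ := exists_nonneg_combination (Finset.univ : Finset (Option ι))
    (fun o => o.elim (-u) p) (-v) fun x hx => by
      have h1 := hx none (Finset.mem_univ _)
      simp only [Option.elim, LinearMap.neg_apply] at h1
      have := h x (fun i => hx (some i) (Finset.mem_univ _)) (by linarith)
      simpa using this
  refine ⟨a none, ha none, fun x hx => ?_⟩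
  have hwx := congrArg (fun f => f x) hw
  simp only [Fintype.sum_option, Option.elim, LinearMap.neg_apply, LinearMap.add_apply,
    LinearMap.smul_apply, LinearMap.sum_apply, smul_eq_mul] at hwx
  have : 0 ≤ ∑ i, a (some i) * p i x := Finset.sum_nonneg fun i _ => mul_nonneg (ha _) (hx i)
  linarith

/-- If `h` is a finite maximum of linear functionals `b t`, and `B` is the maximum of the linear
functionals `a t r` wherever `h` agrees with `b t`, then `B + c * h` is convex for large `c`. -/
theorem exists_convexOn_add_mul {τ ρ V : Type*} [Finite τ] [Finite ρ] [AddCommGroup V]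
    [Module ℝ V] (b : τ → V →ₗ[ℝ] ℝ) (a : τ → ρ → V →ₗ[ℝ] ℝ) (h B : V → ℝ)
    (hle : ∀ x t, b t x ≤ h x) (hex : ∀ x, ∃ t, b t x = h x)
    (hBle : ∀ x t, b t x = h x → ∀ r, a t r x ≤ B x)
    (hBex : ∀ x t, b t x = h x → ∃ r, a t r x = B x) :
    ∃ c₀ : ℝ, ∀ c, c₀ ≤ c → ConvexOn ℝ Set.univ fun x => B x + c * h x := by
  classical
  have key : ∀ q : (τ × ρ) × (τ × ρ), ∃ c : ℝ, 0 ≤ c ∧ ∀ x, b q.1.1 x = h x → a q.1.1 q.1.2 x = B x →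
      a q.2.1 q.2.2 x - B x ≤ c * (h x - b q.2.1 x) := by
    rintro ⟨⟨t, r⟩, ⟨t', r'⟩⟩
    -- These inequalities cut out the cone where `b t` is the largest `b s` and `a t r` the largest
    -- `a t s`, that is, where they equal `h` and `B`.
    obtain ⟨c, hc, H⟩ := exists_le_mul_of_polyhedral
      (fun i : τ ⊕ ρ => i.elim (fun s => b t - b s) (fun s => a t r - a t s))
      (b t - b t') (a t' r' - a t r) fun x hx hu => by
        have h1 : b t x = h x := by
          obtain ⟨s, hs⟩ := hex x
          have := hx (Sum.inl s)
          simp only [Sum.elim_inl, LinearMap.sub_apply] at this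
          exact le_antisymm (hle x t) (by linarith)
        have h2 : a t r x = B x := by
          obtain ⟨s, hs⟩ := hBex x t h1
          have := hx (Sum.inr s)
          simp only [Sum.elim_inr, LinearMap.sub_apply] at this
          exact le_antisymm (hBle x t h1 r) (by linarith)
        rw [LinearMap.sub_apply] at hu ⊢
        -- If the gap `b t - b t'` is nonpositive here, then `t'` attains `h` as well, so its pieces
        -- are bounded by `B`.
        have := hBle x t' (le_antisymm (hle x t') (by linarith)) r'
        linarith
    refine ⟨c, hc, fun x h1 h2 => ?_⟩
    have := H x ?_
    · simp only [LinearMap.sub_apply] at this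
      rwa [h1, h2] at this
    · rintro (s | s)
      · simpa [h1] using hle x s
      · simpa [h2] using hBle x t h1 s
  choose C hC0 hC using key
  obtain ⟨c₀, hc₀⟩ := (Set.finite_range C).bddAbove
  refine ⟨c₀, fun c hc => ⟨convex_univ, fun x _ y _ α β hα hβ hαβ => ?_⟩⟩
  -- Every `a t r + c * b t` lies below `B + c * h`, with equality for some pair at each point, so
  -- `B + c * h` is a maximum of linear functionals.
  have bound : ∀ x t r, a t r x + c * b t x ≤ B x + c * h x := fun x t r => by
    obtain ⟨t', ht'⟩ := hex x
    obtain ⟨r', hr'⟩ := hBex x t' ht'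
    have h1 := hC ((t', r'), (t, r)) x ht' hr'
    have h2 : C ((t', r'), (t, r)) ≤ c := (hc₀ ⟨_, rfl⟩).trans hc
    have h3 := mul_le_mul_of_nonneg_right h2 (sub_nonneg.2 (hle x t))
    simp only at h1
    linarith
  obtain ⟨t, ht⟩ := hex (α • x + β • y)
  obtain ⟨r, hr⟩ := hBex _ t ht
  simp only [smul_eq_mul]
  rw [← hr, ← ht]
  simp only [map_add, map_smul, smul_eq_mul]
  have h1 := mul_le_mul_of_nonneg_left (bound x t r) hα
  have h2 := mul_le_mul_of_nonneg_left (bound y t r) hβ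
  linarith

end Basecondary

/-! ### Submodular functions and the greedy algorithm -/

namespace Basecondary

/-- The marginal values of a set function `f` along the chain of sets that adds the elements in the
order of their ranks. -/
def greedy {ι κ : Type*} [Fintype ι] [LinearOrder κ] (f : Finset ι → ℝ) (r : ι → κ) (i : ι) : ℝ :=
  f (Finset.univ.filter fun j => r j ≤ r i) - f (Finset.univ.filter fun j => r j < r i)

/-- The marginal values telescope along an initial segment of the order. -/
theorem sum_greedy_of_isLower {ι κ : Type*} [Fintype ι] [LinearOrder κ] (f : Finset ι → ℝ)
    {r : ι → κ} (hr : Function.Injective r) (S : Finset ι)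
    (hS : ∀ i ∈ S, ∀ j, r j ≤ r i → j ∈ S) : ∑ i ∈ S, greedy f r i = f S - f ∅ := by
  classical
  induction S using Finset.induction_on_max_value r with
  | empty => simp
  | insert a S ha hmax ih =>
    have hlt : ∀ j, j ∈ S ↔ r j < r a := fun j => by
      refine ⟨fun hj => (hmax j hj).lt_of_ne fun h => ha (hr h ▸ hj), fun hj => ?_⟩
      exact (Finset.mem_insert.1 (hS a (Finset.mem_insert_self _ _) j hj.le)).resolve_left
        (fun h => hj.ne (congrArg r h))
    have hS1 : (Finset.univ.filter fun j => r j < r a) = S := by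
      ext j
      simp [hlt]
    have hS2 : (Finset.univ.filter fun j => r j ≤ r a) = insert a S := by
      ext j
      simp only [Finset.mem_filter, Finset.mem_univ, true_and, Finset.mem_insert, hlt, le_iff_lt_or_eq,
        hr.eq_iff, or_comm]
    rw [Finset.sum_insert ha, ih fun i hi j hj => (hlt j).2 (hj.trans_lt ((hlt i).1 hi)), greedy, hS1,
      hS2]
    ring

/-- Diminishing returns: adding the highest ranked element of `S` to the rest of `S` gains at least
as much as adding it to all elements of smaller rank. Together with the preceding equality on the
whole set, this places the greedy vector in the base polytope of `f`. -/
theorem sum_greedy_le {ι κ : Type*} [Fintype ι] [DecidableEq ι] [LinearOrder κ]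
    (f : Finset ι → ℝ) (hf : ∀ I J, f (I ∩ J) + f (I ∪ J) ≤ f I + f J)
    {r : ι → κ} (hr : Function.Injective r) (S : Finset ι) :
    ∑ i ∈ S, greedy f r i ≤ f S - f ∅ := by
  induction S using Finset.induction_on_max_value r with
  | empty => simp
  | insert a S ha hmax ih =>
    have hlt : ∀ j ∈ S, r j < r a := fun j hj => (hmax j hj).lt_of_ne fun h => ha (hr h ▸ hj)
    have h := hf (insert a S) (Finset.univ.filter fun j => r j < r a)
    have h1 : insert a S ∩ (Finset.univ.filter fun j => r j < r a) = S := by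
      ext j
      simp only [Finset.mem_inter, Finset.mem_insert, Finset.mem_filter, Finset.mem_univ, true_and]
      refine ⟨?_, fun hj => ⟨Or.inr hj, hlt j hj⟩⟩
      rintro ⟨rfl | hj, h⟩
      · exact absurd h (lt_irrefl _)
      · exact hj
    have h2 : insert a S ∪ (Finset.univ.filter fun j => r j < r a) =
        Finset.univ.filter fun j => r j ≤ r a := by
      ext j
      simp only [Finset.mem_union, Finset.mem_insert, Finset.mem_filter, Finset.mem_univ, true_and]
      refine ⟨?_, fun hj => hj.lt_or_eq.elim Or.inr fun h => Or.inl (Or.inl (hr h))⟩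
      rintro ((rfl | hj) | h)
      · exact le_rfl
      · exact hmax j hj
      · exact h.le
    rw [h1, h2] at h
    rw [Finset.sum_insert ha, greedy]
    linarith

/-- Summation over the level sets of `x`, expressed through an order that sorts `x` decreasingly. -/
theorem finsum_mul_level_sub {ι κ : Type*} [Fintype ι] [LinearOrder κ] (f : Finset ι → ℝ)
    {r : ι → κ} (hr : Function.Injective r) (x : ι → ℝ) (hx : ∀ i j, x i < x j → r j < r i)
    (ψ : ℝ → ℝ) :
    ∑ᶠ s, ψ s * (f (Finset.univ.filter fun i => s ≤ x i) - f (Finset.univ.filter fun i => s < x i)) =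
      ∑ i, ψ (x i) * greedy f r i := by
  classical
  have hx' : ∀ i j, r j ≤ r i → x i ≤ x j := fun i j h => not_lt.1 fun h' => (hx j i h').not_ge h
  -- Both level sets are initial segments of the order, so the jump of `f` at level `s` is the sum
  -- of the marginals of the labels with `x i = s`.
  have hlev : ∀ s, f (Finset.univ.filter fun i => s ≤ x i) - f (Finset.univ.filter fun i => s < x i) =
      ∑ i with x i = s, greedy f r i := fun s => by
    have h1 := sum_greedy_of_isLower f hr (Finset.univ.filter fun i => s ≤ x i) fun i hi j hj => by
      simp only [Finset.mem_filter, Finset.mem_univ, true_and] at hi ⊢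
      exact hi.trans (hx' i j hj)
    have h2 := sum_greedy_of_isLower f hr (Finset.univ.filter fun i => s < x i) fun i hi j hj => by
      simp only [Finset.mem_filter, Finset.mem_univ, true_and] at hi ⊢
      exact hi.trans_le (hx' i j hj)
    have h3 : (Finset.univ.filter fun i => s ≤ x i) =
        (Finset.univ.filter fun i => s < x i) ∪ Finset.univ.filter fun i => x i = s := by
      ext i
      simp only [Finset.mem_filter, Finset.mem_univ, true_and, Finset.mem_union, le_iff_lt_or_eq,
        eq_comm]
    have h4 : Disjoint (Finset.univ.filter fun i => s < x i) (Finset.univ.filter fun i => x i = s) := by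
      rw [Finset.disjoint_left]
      intro i hi hi'
      simp only [Finset.mem_filter, Finset.mem_univ, true_and] at hi hi'
      exact hi.ne hi'.symm
    rw [h3, Finset.sum_union h4] at h1
    rw [h3]
    linarith
  simp_rw [hlev]
  rw [finsum_eq_sum_of_support_subset (s := Finset.univ.image x)]
  · rw [← Finset.sum_fiberwise_of_maps_to (s := Finset.univ) (t := Finset.univ.image x) (g := x)
      (fun i _ => Finset.mem_image_of_mem x (Finset.mem_univ i))]
    refine Finset.sum_congr rfl fun s _ => ?_
    rw [Finset.mul_sum]
    refine Finset.sum_congr rfl fun i hi => ?_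
    rw [(Finset.mem_filter.1 hi).2]
  · intro s hs
    by_contra hne
    apply hs
    refine mul_eq_zero_of_right _ (Finset.sum_eq_zero ?_)
    intro i hi
    exact absurd (by simpa using ⟨i, (Finset.mem_filter.1 hi).2⟩) hne

/-- Abel summation: weights with nonnegative partial sums and zero total pair nonnegatively with a
decreasing sequence. -/
theorem sum_mul_nonneg_of_antitone {ι κ : Type*} [Fintype ι] [LinearOrder κ]
    {r : ι → κ} (hr : Function.Injective r) (x w : ι → ℝ) (hx : ∀ i j, r j ≤ r i → x i ≤ x j)
    (hw : ∀ S : Finset ι, (∀ i ∈ S, ∀ j, r j ≤ r i → j ∈ S) → 0 ≤ ∑ i ∈ S, w i)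
    (hw0 : ∑ i, w i = 0) : 0 ≤ ∑ i, x i * w i := by
  classical
  -- The lower bound `c` is a free parameter of the induction: on adding the last element `a`, it is
  -- raised to `x a` on `S`, and the difference is `x a - c` times a partial sum of the weights.
  have key : ∀ S : Finset ι, (∀ i ∈ S, ∀ j, r j ≤ r i → j ∈ S) → ∀ c, (∀ i ∈ S, c ≤ x i) →
      0 ≤ ∑ i ∈ S, (x i - c) * w i := by
    intro S
    induction S using Finset.induction_on_max_value r with
    | empty => simp
    | insert a S ha hmax ih =>
      intro hS c hc
      have hlow : ∀ i ∈ S, ∀ j, r j ≤ r i → j ∈ S := fun i hi j hj => by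
        refine (Finset.mem_insert.1 (hS i (Finset.mem_insert_of_mem hi) j hj)).resolve_left ?_
        rintro rfl
        exact ha (hr (le_antisymm (hmax i hi) hj) ▸ hi)
      have h1 := ih hlow (x a) fun i hi => hx a i (hmax i hi)
      have h2 := mul_nonneg (sub_nonneg.2 (hc a (Finset.mem_insert_self _ _))) (hw _ hS)
      rw [Finset.sum_insert ha, mul_add, Finset.mul_sum] at h2
      rw [Finset.sum_insert ha]
      have h3 : ∑ i ∈ S, (x i - c) * w i = ∑ i ∈ S, (x i - x a) * w i + ∑ i ∈ S, (x a - c) * w i := by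
        rw [← Finset.sum_add_distrib]
        exact Finset.sum_congr rfl fun i _ => by ring
      linarith
  obtain ⟨c, hc⟩ := (Set.finite_range x).bddBelow
  have := key Finset.univ (fun _ _ j _ => Finset.mem_univ j) c fun i _ => hc ⟨i, rfl⟩
  simp only [sub_mul, Finset.sum_sub_distrib, ← Finset.mul_sum, hw0, mul_zero, sub_zero] at this
  exact this

/-- For a submodular function, the greedy vector of the order that sorts `x` maximizes the pairing
with `x`. -/
theorem sum_mul_greedy_le {ι κ κ' : Type*} [Fintype ι] [DecidableEq ι] [LinearOrder κ]
    [LinearOrder κ'] (f : Finset ι → ℝ) (hf : ∀ I J, f (I ∩ J) + f (I ∪ J) ≤ f I + f J)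
    {r : ι → κ} {r' : ι → κ'} (hr : Function.Injective r) (hr' : Function.Injective r')
    (x : ι → ℝ) (hx : ∀ i j, x i < x j → r j < r i) :
    ∑ i, x i * greedy f r' i ≤ ∑ i, x i * greedy f r i := by
  -- On initial segments of `r` the vector of `r` attains the bound that the vector of `r'` obeys on
  -- every set, and the totals agree.
  have := sum_mul_nonneg_of_antitone hr x (fun i => greedy f r i - greedy f r' i)
    (fun i j h => not_lt.1 fun h' => (hx j i h').not_ge h)
    (fun S hS => by
      rw [Finset.sum_sub_distrib, sum_greedy_of_isLower f hr S hS]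
      linarith [sum_greedy_le f hf hr' S])
    (by
      rw [Finset.sum_sub_distrib, sum_greedy_of_isLower f hr _ (by simp),
        sum_greedy_of_isLower f hr' _ (by simp), sub_self])
  simp only [mul_sub, Finset.sum_sub_distrib] at this
  linarith

/-- Every real tuple can be sorted decreasingly. -/
theorem exists_perm_sorting {m : ℕ} (x : Fin m → ℝ) :
    ∃ r : Equiv.Perm (Fin m), ∀ i j, x i < x j → r j < r i := by
  refine ⟨(Tuple.sort (-x)).symm, fun i j hij => ?_⟩
  by_contra! h
  have := Tuple.monotone_sort (-x) h
  simp at this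
  linarith

end Basecondary

/-! ### Simplices, barycentric coordinates and interpolation -/

namespace Basecondary

noncomputable section

open MeasureTheory

/-- The labels in `σ` are those of the vertices of a nondegenerate `n`-simplex. -/
def IsSimplex {m n : ℕ} (A : Fin m → Fin n → ℝ) (σ : Finset (Fin m)) : Prop :=
  σ.card = n + 1 ∧ AffineIndependent ℝ (fun i : σ => A i)

theorem affineMap_sum_apply {ι E : Type*} [AddCommGroup E] [Module ℝ E] (s : Finset ι)
    (f : ι → E →ᵃ[ℝ] ℝ) (x : E) : (∑ i ∈ s, f i) x = ∑ i ∈ s, f i x := by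
  classical
  induction s using Finset.induction_on with
  | empty => simp
  | insert a s ha ih => rw [Finset.sum_insert ha, Finset.sum_insert ha, AffineMap.coe_add, Pi.add_apply, ih]

/-- Affine functions that differ only agree on a null set. -/
theorem volume_setOf_affineMap_eq {n : ℕ} {f g : (Fin n → ℝ) →ᵃ[ℝ] ℝ} (h : f ≠ g) :
    volume {x | f x = g x} = 0 := by
  have hs : {x | f x = g x} = (AffineSubspace.comap (f - g) (AffineSubspace.mk' 0 ⊥) :
      AffineSubspace ℝ (Fin n → ℝ)) := by
    ext x
    simp [sub_eq_zero]
  rw [hs]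
  refine Measure.addHaar_affineSubspace _ _ fun htop => h ?_
  ext x
  have : x ∈ {x | f x = g x} := by
    rw [hs, htop]
    trivial
  exact this

/-- The geometric simplex with label set `σ`. -/
abbrev hull {m n : ℕ} (A : Fin m → Fin n → ℝ) (σ : Finset (Fin m)) : Set (Fin n → ℝ) :=
  convexHull ℝ (A '' (σ : Set (Fin m)))

variable {m n : ℕ} {A : Fin m → Fin n → ℝ} {σ τ : Finset (Fin m)}

/-- The affine basis formed by the vertices of a simplex. -/
def IsSimplex.basis (h : IsSimplex A σ) : AffineBasis σ ℝ (Fin n → ℝ) :=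
  ⟨fun i => A i, h.2, by
    rw [h.2.affineSpan_eq_top_iff_card_eq_finrank_add_one]
    simp [h.1]⟩

open Classical in
/-- The barycentric coordinate of the simplex `σ` belonging to the vertex `i`. -/
def bary (A : Fin m → Fin n → ℝ) (σ : Finset (Fin m)) (i : Fin m) : (Fin n → ℝ) →ᵃ[ℝ] ℝ :=
  if h : IsSimplex A σ ∧ i ∈ σ then h.1.basis.coord ⟨i, h.2⟩ else 0

/-- The affine function that interpolates `l` at the vertices of the simplex `σ`. -/
def interp (A : Fin m → Fin n → ℝ) (σ : Finset (Fin m)) (l : Fin m → ℝ) : (Fin n → ℝ) →ᵃ[ℝ] ℝ :=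
  ∑ i ∈ σ, l i • bary A σ i

theorem interp_apply (l : Fin m → ℝ) (x : Fin n → ℝ) :
    interp A σ l x = ∑ i ∈ σ, l i * bary A σ i x := by
  rw [interp, affineMap_sum_apply]
  rfl

theorem IsSimplex.bary_eq (h : IsSimplex A σ) (i : σ) : bary A σ i = h.basis.coord i := by
  rw [bary, dif_pos ⟨h, i.2⟩]

theorem IsSimplex.bary_apply (h : IsSimplex A σ) {i j : Fin m} (hi : i ∈ σ) (hj : j ∈ σ) :
    bary A σ i (A j) = if i = j then 1 else 0 := by
  rw [h.bary_eq ⟨i, hi⟩]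
  have := h.basis.coord_apply ⟨i, hi⟩ ⟨j, hj⟩
  simp only [Subtype.mk.injEq] at this
  exact this

theorem IsSimplex.sum_bary (h : IsSimplex A σ) (x : Fin n → ℝ) : ∑ i ∈ σ, bary A σ i x = 1 := by
  rw [← h.basis.sum_coord_apply_eq_one x, ← Finset.sum_attach]
  exact Finset.sum_congr rfl fun i _ => by rw [h.bary_eq]

theorem IsSimplex.range_basis (h : IsSimplex A σ) :
    Set.range h.basis = A '' (σ : Set (Fin m)) := by
  ext x
  constructor
  · rintro ⟨i, rfl⟩
    exact ⟨i, i.2, rfl⟩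
  · rintro ⟨i, hi, rfl⟩
    exact ⟨⟨i, hi⟩, rfl⟩

theorem IsSimplex.affineSpan_eq_top (h : IsSimplex A σ) : affineSpan ℝ (A '' σ) = ⊤ := by
  rw [← h.basis.tot]
  rw [h.range_basis]

theorem IsSimplex.affineMap_ext (h : IsSimplex A σ) {f g : (Fin n → ℝ) →ᵃ[ℝ] ℝ}
    (hfg : ∀ i ∈ σ, f (A i) = g (A i)) : f = g := by
  refine AffineMap.ext_on h.affineSpan_eq_top ?_
  rintro _ ⟨i, hi, rfl⟩
  exact hfg i hi

theorem IsSimplex.interp_vertex (h : IsSimplex A σ) (l : Fin m → ℝ) {i : Fin m} (hi : i ∈ σ) :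
    interp A σ l (A i) = l i := by
  rw [interp_apply, Finset.sum_eq_single i]
  · rw [h.bary_apply hi hi, if_pos rfl, mul_one]
  · intro j hj hji
    rw [h.bary_apply hj hi, if_neg hji, mul_zero]
  · exact fun h' => absurd hi h'

theorem IsSimplex.eq_interp (h : IsSimplex A σ) {l : Fin m → ℝ} {f : (Fin n → ℝ) →ᵃ[ℝ] ℝ}
    (hf : ∀ i ∈ σ, f (A i) = l i) : f = interp A σ l :=
  h.affineMap_ext fun i hi => by rw [hf i hi, h.interp_vertex l hi]

theorem IsSimplex.map_eq_sum (h : IsSimplex A σ) (f : (Fin n → ℝ) →ᵃ[ℝ] ℝ) (x : Fin n → ℝ) :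
    f x = ∑ i ∈ σ, f (A i) * bary A σ i x := by
  rw [h.eq_interp (l := fun i => f (A i)) (f := f) fun i _ => rfl, interp_apply]
  refine Finset.sum_congr rfl fun i hi => ?_
  rw [h.interp_vertex _ hi]

theorem IsSimplex.mem_convexHull (h : IsSimplex A σ) {x : Fin n → ℝ} :
    x ∈ hull A σ ↔ ∀ i ∈ σ, 0 ≤ bary A σ i x := by
  rw [hull, ← h.range_basis, h.basis.convexHull_eq_nonneg_coord]
  constructor
  · intro hx i hi
    rw [h.bary_eq ⟨i, hi⟩]
    exact hx _
  · intro hx i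
    rw [← h.bary_eq]
    exact hx i i.2

theorem IsSimplex.sum_bary_smul (h : IsSimplex A σ) (x : Fin n → ℝ) :
    ∑ i ∈ σ, bary A σ i x • A i = x := by
  conv_rhs => rw [← h.basis.linear_combination_coord_eq_self x]
  rw [← Finset.sum_attach]
  exact Finset.sum_congr rfl fun i _ => by rw [h.bary_eq]; rfl

theorem isCompact_hull (A : Fin m → Fin n → ℝ) (s : Set (Fin m)) :
    IsCompact (convexHull ℝ (A '' s)) :=
  ((Set.toFinite s).image A).isCompact_convexHull ℝ

theorem measurableSet_hull (A : Fin m → Fin n → ℝ) (s : Set (Fin m)) :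
    MeasurableSet (convexHull ℝ (A '' s)) :=
  (isCompact_hull A s).isClosed.measurableSet

theorem volume_hull_ne_top (A : Fin m → Fin n → ℝ) (s : Set (Fin m)) :
    volume (convexHull ℝ (A '' s)) ≠ ⊤ :=
  (isCompact_hull A s).measure_lt_top.ne

theorem IsSimplex.volume_hull_ne_zero (h : IsSimplex A σ) : volume (hull A σ) ≠ 0 := by
  have := interior_convexHull_nonempty_iff_affineSpan_eq_top.2 h.affineSpan_eq_top
  exact (Measure.measure_pos_of_nonempty_interior _ this).ne'

/-- Distinct simplices that meet in their common face overlap in a null set. -/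
theorem IsSimplex.volume_inter (h : IsSimplex A σ) (h' : IsSimplex A τ) (hne : σ ≠ τ)
    (hint : hull A σ ∩ hull A τ ⊆ convexHull ℝ (A '' ((σ : Set (Fin m)) ∩ τ))) :
    volume (hull A σ ∩ hull A τ) = 0 := by
  obtain ⟨i, hi, hi'⟩ : ∃ i ∈ σ, i ∉ τ := by
    by_contra! hsub
    exact hne (Finset.eq_of_subset_of_card_le hsub (by rw [h.1, h'.1]))
  -- The common face lies in the hyperplane where the coordinate of the vertex `i` missing from `τ`
  -- vanishes.
  refine measure_mono_null (hint.trans (convexHull_min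
      (t := {x | bary A σ i x = (0 : (Fin n → ℝ) →ᵃ[ℝ] ℝ) x}) ?_ ?_))
    (volume_setOf_affineMap_eq fun h0 => ?_)
  · rintro _ ⟨j, ⟨hj, hj'⟩, rfl⟩
    change bary A σ i (A j) = 0
    rw [h.bary_apply hi hj, if_neg]
    rintro rfl
    exact hi' hj'
  · exact (convex_singleton (0 : ℝ)).affine_preimage (bary A σ i)
  · have := h.bary_apply hi hi
    rw [h0] at this
    simp at this

/-- An affine function bounding another at points bounds it on their convex hull. -/
theorem affineMap_le_on_hull {s : Set (Fin m)} {f g : (Fin n → ℝ) →ᵃ[ℝ] ℝ}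
    (h : ∀ i ∈ s, f (A i) ≤ g (A i)) {x : Fin n → ℝ} (hx : x ∈ convexHull ℝ (A '' s)) :
    f x ≤ g x := by
  have : convexHull ℝ (A '' s) ⊆ (g - f) ⁻¹' Set.Ici 0 := by
    refine convexHull_min ?_ ((convex_Ici _).affine_preimage _)
    rintro _ ⟨i, hi, rfl⟩
    simpa using h i hi
  simpa using this hx

/-- The simplex `σ` belongs to the upper hull of the heights `l`: the interpolation of `l` on `σ`
dominates `l`. -/
def Admissible (A : Fin m → Fin n → ℝ) (l : Fin m → ℝ) (σ : Finset (Fin m)) : Prop :=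
  ∀ i, l i ≤ interp A σ l (A i)

/-- Over a simplex, comparison at the vertices suffices. Consequently the interpolations over two
admissible simplices agree on the overlap of these simplices. -/
theorem IsSimplex.interp_le (h : IsSimplex A σ) {l : Fin m → ℝ} {f : (Fin n → ℝ) →ᵃ[ℝ] ℝ}
    (hf : ∀ i, l i ≤ f (A i)) {x : Fin n → ℝ} (hx : x ∈ hull A σ) : interp A σ l x ≤ f x :=
  affineMap_le_on_hull (s := (σ : Set (Fin m)))
    (fun i hi => by rw [h.interp_vertex l hi]; exact hf i) hx

end

end Basecondary

/-! ### Existence of regular triangulations -/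

namespace Basecondary

noncomputable section

open MeasureTheory

variable {m n : ℕ} {A : Fin m → Fin n → ℝ} {σ τ : Finset (Fin m)}

/-- Points are affinely independent if each can be separated from the others by an affine function
vanishing on the latter. -/
theorem affineIndependent_of_exists_affineMap
    (h : ∀ i ∈ σ, ∃ f : (Fin n → ℝ) →ᵃ[ℝ] ℝ, f (A i) ≠ 0 ∧ ∀ j ∈ σ, j ≠ i → f (A j) = 0) :
    AffineIndependent ℝ (fun i : σ => A i) := by
  rw [affineIndependent_iff]
  intro s w hw hwA i hi
  obtain ⟨f, hfi, hf⟩ := h i i.2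
  have h1 : ∑ j ∈ s, w j * f (A j) = 0 := by
    have h2 : ∀ j, w j * f (A j) = f.linear (w j • A j) + w j * f 0 := fun j => by
      have h3 := congrFun f.decomp (A j)
      simp only [Pi.add_apply] at h3
      rw [h3, map_smul, smul_eq_mul, mul_add]
    rw [Finset.sum_congr rfl fun j _ => h2 j, Finset.sum_add_distrib, ← map_sum, hwA,
      ← Finset.sum_mul, hw]
    simp
  rw [Finset.sum_eq_single_of_mem i hi fun j _ hj => by
    rw [hf j j.2 fun h' => hj (Subtype.ext h'), mul_zero]] at h1
  exact (mul_eq_zero.1 h1).resolve_right hfi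

theorem exists_isSimplex_subset {Q : Set (Fin m)} (hQ : affineSpan ℝ (A '' Q) = ⊤) :
    ∃ σ : Finset (Fin m), (σ : Set (Fin m)) ⊆ Q ∧ IsSimplex A σ := by
  classical
  obtain ⟨t, ht, hspan, hind⟩ := exists_affineIndependent ℝ (Fin n → ℝ) (A '' Q)
  have hfin : t.Finite := ((Set.toFinite Q).image A).subset ht
  have := hfin.fintype
  -- One label is chosen for each point of `t`, so repeated points enter only once.
  choose g hgQ hg using fun x : t => ht x.2
  have hginj : Function.Injective g := fun x y hxy => Subtype.ext (by rw [← hg x, ← hg y, hxy])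
  refine ⟨Finset.univ.image g, ?_, ?_, ?_⟩
  · intro i hi
    obtain ⟨x, -, rfl⟩ := Finset.mem_image.1 hi
    exact hgQ x
  · rw [Finset.card_image_of_injective _ hginj, Finset.card_univ]
    have := hind.affineSpan_eq_top_iff_card_eq_finrank_add_one.1
      (by rw [Subtype.range_coe, hspan, hQ])
    simpa using this
  · have hmem : ∀ i : (Finset.univ.image g : Finset (Fin m)), A i ∈ t := fun i => by
      obtain ⟨x, -, hx⟩ := Finset.mem_image.1 i.2
      rw [← hx, hg]
      exact x.2
    refine hind.comp_embedding
      ⟨fun i : (Finset.univ.image g : Finset (Fin m)) => ⟨A i, hmem i⟩, fun i j hij => ?_⟩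
    obtain ⟨x, -, hx⟩ := Finset.mem_image.1 i.2
    obtain ⟨y, -, hy⟩ := Finset.mem_image.1 j.2
    have hij' : A i = A j := congrArg Subtype.val hij
    rw [← hx, ← hy, hg, hg] at hij'
    exact Subtype.ext (by rw [← hx, ← hy, Subtype.ext hij'])

/-- Moving a dominating affine function in a direction that decreases it at some label until it
touches the heights at a new label. -/
theorem exists_pivot {l : Fin m → ℝ} {γ δ : (Fin n → ℝ) →ᵃ[ℝ] ℝ} (hγ : ∀ i, l i ≤ γ (A i))
    (hδ : ∃ j, δ (A j) < 0) :
    ∃ j, δ (A j) < 0 ∧ ∃ ε : ℝ, (l j < γ (A j) → 0 < ε) ∧ (γ + ε • δ) (A j) = l j ∧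
      ∀ i, l i ≤ (γ + ε • δ) (A i) := by
  classical
  obtain ⟨j₀, hj₀⟩ := hδ
  -- The ratio test of the simplex method: the smallest ratio gives the longest step that violates
  -- no constraint.
  obtain ⟨j, hj, hmin⟩ := Finset.exists_min_image (Finset.univ.filter fun j => δ (A j) < 0)
    (fun j => (γ (A j) - l j) / (-δ (A j))) ⟨j₀, by simpa using hj₀⟩
  simp only [Finset.mem_filter, Finset.mem_univ, true_and] at hj hmin
  have hval : ∀ (ε : ℝ) i, (γ + ε • δ) (A i) = γ (A i) + ε * δ (A i) := fun _ _ => rfl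
  have hε : 0 ≤ (γ (A j) - l j) / (-δ (A j)) :=
    div_nonneg (by linarith [hγ j]) (by linarith)
  refine ⟨j, hj, (γ (A j) - l j) / (-δ (A j)), fun h => div_pos (by linarith) (by linarith), ?_,
    fun i => ?_⟩
  · rw [hval]
    have : δ (A j) ≠ 0 := hj.ne
    field_simp
    ring
  · rw [hval]
    rcases lt_or_ge (δ (A i)) 0 with hi | hi
    · have := hmin i hi
      rw [le_div_iff₀ (by linarith)] at this
      linarith
    · have := mul_nonneg hε hi
      linarith [hγ i]

/-- An affine function vanishing on given points and negative at a further one. -/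
theorem exists_affineMap_neg {n : ℕ} {S : Set (Fin n → ℝ)} {p : Fin n → ℝ}
    (hp : p ∉ affineSpan ℝ S) :
    ∃ δ : (Fin n → ℝ) →ᵃ[ℝ] ℝ, (∀ x ∈ S, δ x = 0) ∧ δ p < 0 := by
  rcases S.eq_empty_or_nonempty with rfl | ⟨q, hq⟩
  · exact ⟨AffineMap.const ℝ _ (-1), by simp, by simp⟩
  · have hnot : p - q ∉ vectorSpan ℝ S := fun h => hp <| by
      simpa using vadd_mem_affineSpan_of_mem_affineSpan_of_mem_vectorSpan
        (mem_affineSpan ℝ hq) h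
    obtain ⟨f, hf, hle⟩ := Submodule.exists_le_ker_of_notMem hnot
    have hval : ∀ (c : ℝ) x, (c • (f.toAffineMap - AffineMap.const ℝ (Fin n → ℝ) (f q))) x =
      c * (f x - f q) := fun _ _ => rfl
    refine ⟨(-(f (p - q))) • (f.toAffineMap - AffineMap.const ℝ _ (f q)), fun x hx => ?_, ?_⟩
    · have : f (x - q) = 0 := hle (vsub_mem_vectorSpan ℝ hx hq)
      rw [hval, ← map_sub, this, mul_zero]
    · rw [hval, ← map_sub, neg_mul]
      have := mul_self_pos.2 hf
      linarith

/-- A dominating affine function with a maximal set of tight labels has a spanning tight set: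
otherwise a pivot in a direction vanishing on the tight points would make a further label tight. -/
theorem exists_admissible_isSimplex (hA : affineSpan ℝ (Set.range A) = ⊤) (l : Fin m → ℝ) :
    ∃ σ, IsSimplex A σ ∧ Admissible A l σ := by
  classical
  let tight : ((Fin n → ℝ) →ᵃ[ℝ] ℝ) → Finset (Fin m) := fun γ =>
    Finset.univ.filter fun i => γ (A i) = l i
  have hfeas : ∃ γ : (Fin n → ℝ) →ᵃ[ℝ] ℝ, ∀ i, l i ≤ γ (A i) := by
    obtain ⟨c, hc⟩ := (Set.finite_range l).bddAbove
    exact ⟨AffineMap.const ℝ _ c, fun i => by simpa using hc ⟨i, rfl⟩⟩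
  obtain ⟨Q, ⟨γ, hγ, rfl⟩, hmax⟩ := (Set.toFinite {Q | ∃ γ : (Fin n → ℝ) →ᵃ[ℝ] ℝ,
    (∀ i, l i ≤ γ (A i)) ∧ tight γ = Q}).exists_maximal (by
      obtain ⟨γ, hγ⟩ := hfeas
      exact ⟨tight γ, γ, hγ, rfl⟩)
  have hspan : affineSpan ℝ (A '' (tight γ : Set (Fin m))) = ⊤ := by
    by_contra hne
    obtain ⟨j, hj⟩ : ∃ j, A j ∉ affineSpan ℝ (A '' (tight γ : Set (Fin m))) := by
      by_contra! hall
      apply hne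
      rw [eq_top_iff, ← hA, affineSpan_le]
      rintro _ ⟨j, rfl⟩
      exact hall j
    obtain ⟨δ, hδ, hδj⟩ := exists_affineMap_neg hj
    obtain ⟨k, hk, ε, -, htight, hfeas'⟩ := exists_pivot hγ ⟨j, hδj⟩
    have hsub : tight γ ≤ tight (γ + ε • δ) := by
      intro i hi
      have h1 : δ (A i) = 0 := hδ _ ⟨i, hi, rfl⟩
      have h2 : γ (A i) = l i := (Finset.mem_filter.1 hi).2
      refine Finset.mem_filter.2 ⟨Finset.mem_univ _, ?_⟩
      change γ (A i) + ε * δ (A i) = l i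
      rw [h1, h2, mul_zero, add_zero]
    have hmem := hmax ⟨_, hfeas', rfl⟩ hsub
      (Finset.mem_filter.2 ⟨Finset.mem_univ k, htight⟩ : k ∈ tight (γ + ε • δ))
    exact hk.ne (hδ _ ⟨k, hmem, rfl⟩)
  obtain ⟨σ, hσQ, hσ⟩ := exists_isSimplex_subset hspan
  refine ⟨σ, hσ, fun i => ?_⟩
  rw [← hσ.eq_interp (f := γ) fun i hi => (Finset.mem_filter.1 (hσQ hi)).2]
  exact hγ i

/-- The heights `l` are generic if no lifted point lies on the hyperplane through the vertices of a
lifted simplex other than these vertices. -/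
def IsGeneric (A : Fin m → Fin n → ℝ) (l : Fin m → ℝ) : Prop :=
  ∀ σ, IsSimplex A σ → ∀ j ∉ σ, interp A σ l (A j) ≠ l j

/-- Replacing a vertex of a simplex by a point outside the opposite facet hyperplane. -/
theorem IsSimplex.insert_erase (h : IsSimplex A σ) {j k : Fin m} (hk : k ∈ σ) (hj : j ∉ σ)
    (hjk : bary A σ k (A j) ≠ 0) : IsSimplex A (insert j (σ.erase k)) := by
  have hj' : j ∉ σ.erase k := fun h' => hj (Finset.mem_of_mem_erase h')
  refine ⟨?_, affineIndependent_of_exists_affineMap fun i hi => ?_⟩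
  · rw [Finset.card_insert_of_notMem hj', Finset.card_erase_of_mem hk, h.1]
    rfl
  · have hval : ∀ (f g : (Fin n → ℝ) →ᵃ[ℝ] ℝ) (c : ℝ) x, (f - c • g) x = f x - c * g x :=
      fun _ _ _ _ => rfl
    have hk0 : ∀ i ∈ σ.erase k, bary A σ k (A i) = 0 := fun i hi => by
      rw [h.bary_apply hk (Finset.mem_of_mem_erase hi), if_neg (Finset.ne_of_mem_erase hi).symm]
    rcases Finset.mem_insert.1 hi with rfl | hi
    · exact ⟨bary A σ k, hjk, fun i' hi' hne =>
        hk0 i' ((Finset.mem_insert.1 hi').resolve_left hne)⟩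
    · have hiσ := Finset.mem_of_mem_erase hi
      refine ⟨bary A σ i - (bary A σ i (A j) / bary A σ k (A j)) • bary A σ k, ?_,
        fun i' hi' hne => ?_⟩
      · rw [hval, hk0 i hi, h.bary_apply hiσ hiσ]
        simp
      · rw [hval]
        rcases Finset.mem_insert.1 hi' with rfl | hi'
        · field_simp
          simp
        · rw [hk0 i' hi', h.bary_apply hiσ (Finset.mem_of_mem_erase hi'), if_neg hne.symm]
          simp

/-- The admissible simplices of generic heights cover the configuration polytope. -/
theorem exists_admissible_mem_hull (hA : affineSpan ℝ (Set.range A) = ⊤) {l : Fin m → ℝ}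
    (hl : IsGeneric A l) {x : Fin n → ℝ} (hx : x ∈ convexHull ℝ (Set.range A)) :
    ∃ σ, IsSimplex A σ ∧ Admissible A l σ ∧ x ∈ hull A σ := by
  classical
  -- The simplex containing `x` is the one that solves a linear program: its interpolation is
  -- minimal at `x` among the admissible simplices.
  obtain ⟨σ, ⟨hσ, hadm⟩, hmin⟩ :=
    (Set.toFinite {σ | IsSimplex A σ ∧ Admissible A l σ}).exists_minimalFor (fun σ => interp A σ l x) _ (exists_admissible_isSimplex hA l)
  refine ⟨σ, hσ, hadm, hσ.mem_convexHull.2 fun k hk => ?_⟩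
  by_contra! hneg
  have hex : ∃ j, bary A σ k (A j) < 0 := by
    by_contra! hall
    refine hneg.not_ge (affineMap_le_on_hull (A := A) (s := Set.univ) (f := 0) (fun i _ => hall i) ?_)
    rwa [Set.image_univ]
  obtain ⟨j, hj, ε, hε, htight, hfeas⟩ := exists_pivot hadm hex
  have hjσ : j ∉ σ := fun hjσ => by
    rw [hσ.bary_apply hk hjσ] at hj
    split_ifs at hj <;> linarith
  -- Genericity makes the pivot step strictly positive, so the value at `x`, where the coordinate of
  -- `k` is negative, drops strictly.
  have hε := hε ((hadm j).lt_of_ne (hl σ hσ j hjσ).symm)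
  have hσ' := hσ.insert_erase hk hjσ hj.ne
  have heq := hσ'.eq_interp (l := l) (f := interp A σ l + ε • bary A σ k) fun i hi => by
    rcases Finset.mem_insert.1 hi with rfl | hi
    · exact htight
    · have hiσ := Finset.mem_of_mem_erase hi
      change interp A σ l (A i) + ε * bary A σ k (A i) = l i
      rw [hσ.interp_vertex l hiσ, hσ.bary_apply hk hiσ, if_neg (Finset.ne_of_mem_erase hi).symm]
      simp
  have hadm' : Admissible A l (insert j (σ.erase k)) := fun i => by
    rw [← heq]
    exact hfeas i
  have hlt : interp A (insert j (σ.erase k)) l x < interp A σ l x := by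
    rw [← heq]
    change interp A σ l x + ε * bary A σ k x < _
    have := mul_neg_of_pos_of_neg hε hneg
    linarith
  exact hlt.not_ge (hmin ⟨hσ', hadm'⟩ hlt.le)

/-- Admissible simplices of generic heights meet in the hull of their common vertices. -/
theorem IsSimplex.hull_inter_hull (hσ : IsSimplex A σ) (hτ : IsSimplex A τ) {l : Fin m → ℝ}
    (hl : IsGeneric A l) (hσl : Admissible A l σ) (hτl : Admissible A l τ) :
    hull A σ ∩ hull A τ = convexHull ℝ (A '' ((σ : Set (Fin m)) ∩ τ)) := by
  apply Set.Subset.antisymm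
  · rintro x ⟨hxσ, hxτ⟩
    have heq : interp A σ l x = interp A τ l x :=
      le_antisymm (hσ.interp_le hτl hxσ) (hτ.interp_le hσl hxτ)
    have hb := hσ.mem_convexHull.1 hxσ
    -- In the coordinates of `σ`, the difference of the interpolations at `x` is a vanishing sum of
    -- nonnegative terms; by genericity the factor in front of the coordinate of `i ∉ τ` is nonzero.
    rw [interp_apply, hσ.map_eq_sum (interp A τ l) x, ← sub_eq_zero, ← neg_eq_zero, neg_sub,
      ← Finset.sum_sub_distrib, Finset.sum_eq_zero_iff_of_nonneg fun i hi => by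
        rw [← sub_mul]
        exact mul_nonneg (sub_nonneg.2 (hτl i)) (hb i hi)] at heq
    have hzero : ∀ i ∈ σ, i ∉ τ → bary A σ i x = 0 := fun i hi hiτ => by
      have := heq i hi
      rw [← sub_mul, mul_eq_zero] at this
      exact this.resolve_left (sub_ne_zero.2 (hl τ hτ i hiτ))
    rw [← hσ.sum_bary_smul x, ← Finset.sum_filter_add_sum_filter_not σ (fun i => i ∈ τ),
      Finset.sum_eq_zero (s := σ.filter fun i => i ∉ τ) fun i hi => by
        rw [hzero i (Finset.mem_filter.1 hi).1 (Finset.mem_filter.1 hi).2, zero_smul], add_zero]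
    refine (convex_convexHull ℝ _).sum_mem (fun i hi => hb i (Finset.mem_filter.1 hi).1) ?_
      fun i hi => subset_convexHull ℝ _ ⟨i, Finset.mem_filter.1 hi, rfl⟩
    rw [← hσ.sum_bary x, ← Finset.sum_filter_add_sum_filter_not σ (fun i => i ∈ τ),
      Finset.sum_eq_zero (s := σ.filter fun i => i ∉ τ) fun i hi =>
        hzero i (Finset.mem_filter.1 hi).1 (Finset.mem_filter.1 hi).2, add_zero]
  · exact Set.subset_inter (convexHull_mono (Set.image_mono Set.inter_subset_left))
      (convexHull_mono (Set.image_mono Set.inter_subset_right))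

/-- The height of the interpolation over `σ` above the lifted point `i`, as a functional of the
heights. -/
def slack (A : Fin m → Fin n → ℝ) (σ : Finset (Fin m)) (i : Fin m) : (Fin m → ℝ) →ₗ[ℝ] ℝ :=
  ∑ k ∈ σ, bary A σ k (A i) • (LinearMap.proj k : (Fin m → ℝ) →ₗ[ℝ] ℝ) - LinearMap.proj i

theorem slack_apply (A : Fin m → Fin n → ℝ) (σ : Finset (Fin m)) (i : Fin m) (l : Fin m → ℝ) :
    slack A σ i l = interp A σ l (A i) - l i := by
  simp [slack, interp_apply, mul_comm]

/-- Heights can be perturbed to generic ones without creating new admissible simplices. -/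
theorem exists_isGeneric (A : Fin m → Fin n → ℝ) (l : Fin m → ℝ) :
    ∃ l', IsGeneric A l' ∧ ∀ σ, Admissible A l' σ → Admissible A l σ := by
  -- `U` is an open neighbourhood of `l` on which negative slacks stay negative; the nongeneric
  -- heights lie in finitely many hyperplanes and cannot fill it.
  let U : Set (Fin m → ℝ) := ⋂ q : Finset (Fin m) × Fin m,
    {l' | slack A q.1 q.2 l < 0 → slack A q.1 q.2 l' < 0}
  have hU : IsOpen U := isOpen_iInter_of_finite fun q => by
    by_cases h : slack A q.1 q.2 l < 0
    · simp only [h, forall_const]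
      exact isOpen_lt (slack A q.1 q.2).continuous_of_finiteDimensional continuous_const
    · simp [h]
  have hlU : l ∈ U := Set.mem_iInter.2 fun q h => h
  let bad : Set (Fin m → ℝ) := ⋃ q : {q : Finset (Fin m) × Fin m // q.2 ∉ q.1},
    {l' | (slack A q.1.1 q.1.2).toAffineMap l' = (0 : (Fin m → ℝ) →ᵃ[ℝ] ℝ) l'}
  have hbad : volume bad = 0 := measure_iUnion_null fun q => volume_setOf_affineMap_eq fun h => by
    have h1 := congrArg (fun f => f (Pi.single q.1.2 1)) h
    have h2 : slack A q.1.1 q.1.2 (Pi.single q.1.2 1) = 0 := h1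
    rw [slack_apply, interp_apply, Finset.sum_eq_zero fun i hi => by
      rw [Pi.single_eq_of_ne (ne_of_mem_of_not_mem hi q.2), zero_mul]] at h2
    simp at h2
  obtain ⟨l', hl'U, hl'⟩ : ∃ l' ∈ U, l' ∉ bad := by
    by_contra! hsub
    exact (hU.measure_pos volume ⟨l, hlU⟩).ne' (measure_mono_null hsub hbad)
  refine ⟨l', fun σ _ j hj h => hl' (Set.mem_iUnion.2 ⟨⟨(σ, j), hj⟩, ?_⟩), fun σ hσ i => ?_⟩
  · change slack A σ j l' = 0
    rw [slack_apply, h, sub_self]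
  · by_contra! hlt
    have h1 := Set.mem_iInter.1 hl'U (σ, i)
    have h2 : slack A σ i l' < 0 := h1 (by rw [slack_apply]; linarith)
    rw [slack_apply] at h2
    linarith [hσ i]

/-- For arbitrary heights there is a triangulation refining the induced regular subdivision. -/
theorem exists_admissible_triangulation (hA : affineSpan ℝ (Set.range A) = ⊤) (l : Fin m → ℝ) :
    ∃ T, IsTriangulation A T ∧ ∀ σ ∈ T, Admissible A l σ := by
  classical
  obtain ⟨l', hgen, hadm⟩ := exists_isGeneric A l
  refine ⟨Finset.univ.filter fun σ => IsSimplex A σ ∧ Admissible A l' σ, ⟨?_, ?_, ?_⟩, ?_⟩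
  · intro σ hσ
    exact (Finset.mem_filter.1 hσ).2.1
  · refine Set.Subset.antisymm (Set.iUnion₂_subset fun σ _ =>
      convexHull_mono (Set.image_subset_range _ _)) fun x hx => ?_
    obtain ⟨σ, hσ, hσl, hxσ⟩ := exists_admissible_mem_hull hA hgen hx
    exact Set.mem_iUnion₂.2 ⟨σ, by simp [hσ, hσl], hxσ⟩
  · intro σ hσ τ hτ
    have hσ := (Finset.mem_filter.1 hσ).2
    have hτ := (Finset.mem_filter.1 hτ).2
    exact hσ.1.hull_inter_hull hτ.1 hgen hσ.2 hτ.2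
  · intro σ hσ
    exact hadm σ (Finset.mem_filter.1 hσ).2.2

end

end Basecondary

/-! ### GKZ vectors as integrals, and secondary cones -/

namespace Basecondary

noncomputable section

open MeasureTheory

variable {m n : ℕ} {A : Fin m → Fin n → ℝ} {σ τ : Finset (Fin m)} {T : Finset (Finset (Fin m))}

theorem integrableOn_hull (s : Set (Fin m)) {f : (Fin n → ℝ) → ℝ} (hf : Continuous f) :
    IntegrableOn f (convexHull ℝ (A '' s)) :=
  hf.continuousOn.integrableOn_compact (isCompact_hull A s)

/-- Barycentric coordinates of a simplex have equal integrals, since vertices can be swapped by an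
affine involution. -/
theorem IsSimplex.setIntegral_bary_eq (h : IsSimplex A σ) {i j : Fin m} (hi : i ∈ σ) (hj : j ∈ σ) :
    ∫ x in hull A σ, bary A σ i x = ∫ x in hull A σ, bary A σ j x := by
  rcases eq_or_ne i j with rfl | hij
  · rfl
  -- `e` swaps `A i` and `A j` and fixes the other vertices. Being an involution, it has determinant
  -- `±1` and preserves volume.
  let e : (Fin n → ℝ) →ᵃ[ℝ] (Fin n → ℝ) := AffineMap.id ℝ _ +
    (LinearMap.toSpanSingleton ℝ (Fin n → ℝ) (A j - A i)).toAffineMap.comp (bary A σ i - bary A σ j)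
  have he : ∀ x, e x = x + (bary A σ i x - bary A σ j x) • (A j - A i) := fun _ => rfl
  have hei : e (A i) = A j := by
    rw [he, h.bary_apply hi hi, h.bary_apply hj hi, if_pos rfl, if_neg hij.symm]
    simp
  have hej : e (A j) = A i := by
    rw [he, h.bary_apply hi hj, h.bary_apply hj hj, if_pos rfl, if_neg hij]
    simp
  have hek : ∀ k ∈ σ, k ≠ i → k ≠ j → e (A k) = A k := fun k hk hki hkj => by
    rw [he, h.bary_apply hi hk, h.bary_apply hj hk, if_neg hki.symm, if_neg hkj.symm]
    simp
  have hei' : (bary A σ i).comp e = bary A σ j := h.affineMap_ext fun k hk => by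
    rw [AffineMap.comp_apply]
    by_cases hki : k = i
    · rw [hki, hei, h.bary_apply hi hj, h.bary_apply hj hi, if_neg hij, if_neg hij.symm]
    by_cases hkj : k = j
    · rw [hkj, hej, h.bary_apply hi hi, h.bary_apply hj hj, if_pos rfl, if_pos rfl]
    rw [hek k hk hki hkj, h.bary_apply hi hk, h.bary_apply hj hk, if_neg (Ne.symm hki),
      if_neg (Ne.symm hkj)]
  have hej' : (bary A σ j).comp e = bary A σ i := h.affineMap_ext fun k hk => by
    rw [AffineMap.comp_apply]
    by_cases hki : k = i
    · rw [hki, hei, h.bary_apply hj hj, h.bary_apply hi hi, if_pos rfl, if_pos rfl]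
    by_cases hkj : k = j
    · rw [hkj, hej, h.bary_apply hj hi, h.bary_apply hi hj, if_neg hij, if_neg hij.symm]
    rw [hek k hk hki hkj, h.bary_apply hi hk, h.bary_apply hj hk, if_neg (Ne.symm hki),
      if_neg (Ne.symm hkj)]
  have hei'' : ∀ x, bary A σ i (e x) = bary A σ j x := fun x => congrArg (fun f => f x) hei'
  have hej'' : ∀ x, bary A σ j (e x) = bary A σ i x := fun x => congrArg (fun f => f x) hej'
  have hinv : ∀ x, e (e x) = x := fun x => by
    rw [he (e x), hei'', hej'', he x, add_assoc, ← add_smul]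
    simp
  have hmaps : ∀ x ∈ hull A σ, e x ∈ hull A σ := fun x hx => by
    have : e x ∈ e '' hull A σ := ⟨x, hx, rfl⟩
    rw [hull, e.image_convexHull] at this
    refine convexHull_min ?_ (convex_convexHull ℝ _) this
    rintro _ ⟨_, ⟨k, hk, rfl⟩, rfl⟩
    refine subset_convexHull ℝ _ ?_
    by_cases hki : k = i
    · exact ⟨j, hj, by rw [hki, hei]⟩
    by_cases hkj : k = j
    · exact ⟨i, hi, by rw [hkj, hej]⟩
    exact ⟨k, hk, by rw [hek k hk hki hkj]⟩
  have himage : e '' hull A σ = hull A σ := by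
    refine Set.Subset.antisymm (Set.image_subset_iff.2 hmaps) fun x hx => ⟨e x, hmaps x hx, hinv x⟩
  have hdet : |(LinearMap.toContinuousLinearMap e.linear).det| = 1 := by
    have hcomp : e.linear.comp e.linear = LinearMap.id := by
      rw [← AffineMap.comp_linear, show e.comp e = AffineMap.id ℝ _ from AffineMap.ext hinv]
      rfl
    have := congrArg LinearMap.det hcomp
    rw [LinearMap.det_comp, LinearMap.det_id] at this
    rw [ContinuousLinearMap.det, LinearMap.coe_toContinuousLinearMap]
    rcases mul_self_eq_one_iff.1 this with h | h <;> simp [h]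
  have hfd : ∀ x ∈ hull A σ, HasFDerivWithinAt e (LinearMap.toContinuousLinearMap e.linear)
      (hull A σ) x := fun x _ => by
    have h1 := (LinearMap.toContinuousLinearMap e.linear).hasFDerivWithinAt (s := hull A σ) (x := x)
    have h2 := h1.add_const (e 0)
    refine h2.congr_of_eventuallyEq ?_ ?_
    · exact Filter.Eventually.of_forall fun y => congrFun e.decomp y
    · exact congrFun e.decomp x
  have := integral_image_eq_integral_abs_det_fderiv_smul volume (measurableSet_hull A σ) hfd
    (fun x _ y _ hxy => by rw [← hinv x, hxy, hinv y]) (fun x => bary A σ i x)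
  rw [himage, hdet] at this
  simpa only [one_smul, hei''] using this

/-- The integral of an affine function over a simplex is the volume times the mean value at the
vertices. -/
theorem IsSimplex.setIntegral_hull (h : IsSimplex A σ) (f : (Fin n → ℝ) →ᵃ[ℝ] ℝ) :
    (n + 1) * ∫ x in hull A σ, f x = volume.real (hull A σ) * ∑ i ∈ σ, f (A i) := by
  have hint : ∀ i, IntegrableOn (fun x => bary A σ i x) (hull A σ) := fun i =>
    integrableOn_hull _ (bary A σ i).continuous_of_finiteDimensional
  have hb : ∀ i ∈ σ, (n + 1) * ∫ x in hull A σ, bary A σ i x = volume.real (hull A σ) := fun i hi => by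
    have h1 : ∑ j ∈ σ, ∫ x in hull A σ, bary A σ j x = volume.real (hull A σ) := by
      rw [← integral_finsetSum _ fun j _ => hint j]
      simp [h.sum_bary]
    rw [← h1, Finset.sum_congr rfl fun j hj => h.setIntegral_bary_eq hj hi, Finset.sum_const, h.1,
      nsmul_eq_mul]
    push_cast
    rfl
  have h1 : ∫ x in hull A σ, f x = ∑ i ∈ σ, f (A i) * ∫ x in hull A σ, bary A σ i x := by
    rw [integral_congr_ae (Filter.Eventually.of_forall fun x => h.map_eq_sum f x),
      integral_finsetSum _ fun j _ => (hint j).const_mul _]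
    exact Finset.sum_congr rfl fun i _ => integral_const_mul _ _
  rw [h1, Finset.mul_sum, Finset.mul_sum]
  refine Finset.sum_congr rfl fun i hi => ?_
  rw [← hb i hi]
  ring

theorem IsTriangulation.isSimplex (hT : IsTriangulation A T) (hσ : σ ∈ T) : IsSimplex A σ :=
  hT.1 σ hσ

theorem IsTriangulation.volume_inter (hT : IsTriangulation A T) (hσ : σ ∈ T) (hτ : τ ∈ T)
    (hne : σ ≠ τ) : volume (hull A σ ∩ hull A τ) = 0 :=
  (hT.isSimplex hσ).volume_inter (hT.isSimplex hτ) hne (hT.2.2 σ hσ τ hτ).subset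

theorem IsTriangulation.setIntegral (hT : IsTriangulation A T) {f : (Fin n → ℝ) → ℝ}
    (hf : Continuous f) :
    ∫ x in convexHull ℝ (Set.range A), f x = ∑ σ ∈ T, ∫ x in hull A σ, f x := by
  have hU : convexHull ℝ (Set.range A) = ⋃ σ : T, hull A σ := by
    rw [← hT.2.1]
    exact Set.biUnion_eq_iUnion _ _
  have hint := integrableOn_hull (A := A) Set.univ hf
  rw [Set.image_univ] at hint
  rw [hU] at hint ⊢
  rw [integral_iUnion_ae (fun σ => (measurableSet_hull A _).nullMeasurableSet) (fun σ τ hne =>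
    hT.volume_inter σ.2 τ.2 fun h => hne (Subtype.ext h)) hint, tsum_fintype]
  exact Finset.sum_coe_sort T fun σ => ∫ x in hull A σ, f x

theorem sum_mul_gkzVector (l : Fin m → ℝ) :
    ∑ i, l i * gkzVector A T i = ∑ σ ∈ T, latticeVol (A '' (σ : Set (Fin m))) * ∑ i ∈ σ, l i := by
  classical
  simp only [gkzVector, Finset.mul_sum, Finset.sum_filter, mul_ite, mul_zero]
  rw [Finset.sum_comm]
  refine Finset.sum_congr rfl fun σ _ => ?_
  rw [← Finset.sum_filter, Finset.filter_mem_eq_inter, Finset.univ_inter]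
  exact Finset.sum_congr rfl fun i _ => mul_comm _ _

/-- The pairing with the Gelfand–Kapranov–Zelevinsky vector integrates the piecewise linear
interpolation. -/
theorem IsTriangulation.sum_mul_gkzVector (hT : IsTriangulation A T) (l : Fin m → ℝ) :
    ∑ i, l i * gkzVector A T i =
      n.factorial * (n + 1) * ∑ σ ∈ T, ∫ x in hull A σ, interp A σ l x := by
  rw [Basecondary.sum_mul_gkzVector, Finset.mul_sum]
  refine Finset.sum_congr rfl fun σ hσ => ?_
  have hs := hT.isSimplex hσ
  rw [mul_assoc, hs.setIntegral_hull, latticeVol, ← mul_assoc,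
    Finset.sum_congr rfl fun i hi => hs.interp_vertex l hi]

/-- A triangulation whose pairing with `l` is at least that of an admissible triangulation is
admissible itself. -/
theorem IsTriangulation.admissible_of_le {T' : Finset (Finset (Fin m))} (hT : IsTriangulation A T)
    (hT' : IsTriangulation A T') {l : Fin m → ℝ} (hl : ∀ σ ∈ T', Admissible A l σ)
    (hle : ∑ i, l i * gkzVector A T' i ≤ ∑ i, l i * gkzVector A T i) :
    ∀ σ ∈ T, Admissible A l σ := by
  intro σ hσ
  have hσs := hT.isSimplex hσ
  have hne : T'.Nonempty := by
    rw [Finset.nonempty_iff_ne_empty]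
    rintro rfl
    have h1 := hT'.2.1
    have h2 : (hull A σ).Nonempty := nonempty_of_measure_ne_zero hσs.volume_hull_ne_zero
    obtain ⟨x, hx⟩ := h2
    have h3 : x ∈ convexHull ℝ (Set.range A) := convexHull_mono (Set.image_subset_range _ _) hx
    rw [← h1] at h3
    simp at h3
  -- On the configuration polytope `g` is the upper hull of the heights: the simplices of `T'`
  -- interpolate it, and those of `T` stay below. The comparison of integrals then forces equality
  -- almost everywhere on each simplex of `T`.
  let g : (Fin n → ℝ) → ℝ := fun x => T'.inf' hne fun τ => interp A τ l x
  have hcont : ∀ τ, Continuous (interp A τ l) := fun τ => (interp A τ l).continuous_of_finiteDimensional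
  have hg : Continuous g := Continuous.finset_inf'_apply hne fun τ _ => hcont τ
  have hgT : ∀ τ ∈ T, ∀ x ∈ hull A τ, interp A τ l x ≤ g x := fun τ hτ x hx =>
    Finset.le_inf' _ _ fun τ' hτ' => (hT.isSimplex hτ).interp_le (hl τ' hτ') hx
  have hgT' : ∀ τ ∈ T', ∀ x ∈ hull A τ, g x = interp A τ l x := fun τ hτ x hx =>
    le_antisymm (Finset.inf'_le _ hτ) (Finset.le_inf' _ _ fun τ' hτ' =>
      (hT'.isSimplex hτ).interp_le (hl τ' hτ') hx)
  rw [hT'.sum_mul_gkzVector, hT.sum_mul_gkzVector] at hle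
  have hle := le_of_mul_le_mul_left hle (by positivity)
  have hsum : ∑ τ ∈ T', ∫ x in hull A τ, interp A τ l x = ∑ τ ∈ T', ∫ x in hull A τ, g x :=
    Finset.sum_congr rfl fun τ hτ => setIntegral_congr_fun (measurableSet_hull A (τ : Set (Fin m)))
      fun x hx => (hgT' τ hτ x hx).symm
  rw [hsum, ← hT'.setIntegral hg, hT.setIntegral hg, ← sub_nonneg,
    ← Finset.sum_sub_distrib] at hle
  have hnn : ∀ τ ∈ T, 0 ≤ ∫ x in hull A τ, (g x - interp A τ l x) := fun τ hτ =>
    setIntegral_nonneg (measurableSet_hull A τ) fun x hx => sub_nonneg.2 (hgT τ hτ x hx)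
  have hzero : ∫ x in hull A σ, (g x - interp A σ l x) = 0 := by
    have h1 : ∀ τ ∈ T, ∫ x in hull A τ, (g x - interp A τ l x) =
        (∫ x in hull A τ, g x) - ∫ x in hull A τ, interp A τ l x := fun τ _ =>
      integral_sub (integrableOn_hull _ hg) (integrableOn_hull _ (hcont τ))
    refine le_antisymm ?_ (hnn σ hσ)
    have h2 := Finset.single_le_sum hnn hσ
    refine h2.trans ?_
    rw [Finset.sum_congr rfl h1]
    simp only [Finset.sum_sub_distrib] at hle ⊢
    linarith
  rw [setIntegral_eq_zero_iff_of_nonneg_ae ((ae_restrict_iff' (measurableSet_hull A σ)).2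
    (Filter.Eventually.of_forall fun x hx => sub_nonneg.2 (hgT σ hσ x hx)))
    (integrableOn_hull _ (hg.sub (hcont σ)))] at hzero
  -- On `σ` the interpolation agrees almost everywhere with a minimum of finitely many affine
  -- functions; as `σ` has positive volume, it must coincide with one of them.
  obtain ⟨τ, hτ, heq⟩ : ∃ τ ∈ T', interp A σ l = interp A τ l := by
    by_contra! hno
    apply hσs.volume_hull_ne_zero
    have hnull : volume (⋃ τ ∈ T', {x | interp A σ l x = interp A τ l x}) = 0 :=
      (measure_biUnion_null_iff T'.countable_toSet).2 fun τ hτ => volume_setOf_affineMap_eq (hno τ hτ)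
    have hae := (ae_restrict_iff' (measurableSet_hull A σ)).1 hzero
    refine measure_mono_null (t := {x | ¬ (x ∈ hull A σ → g x - interp A σ l x = 0)} ∪
      ⋃ τ ∈ T', {x | interp A σ l x = interp A τ l x}) (fun x hx => ?_)
      (measure_union_null (ae_iff.1 hae) hnull)
    by_cases h : g x - interp A σ l x = 0
    · right
      obtain ⟨τ, hτ, hgτ⟩ := Finset.exists_mem_eq_inf' hne fun τ => interp A τ l x
      exact Set.mem_iUnion₂.2 ⟨τ, hτ, (sub_eq_zero.1 h).symm.trans hgτ⟩
    · exact Or.inl fun h' => h (h' hx)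
  intro i
  rw [heq]
  exact hl τ hτ i

end

end Basecondary

/-! ### The basecondary function on a secondary cone -/

namespace Basecondary

noncomputable section

open MeasureTheory

variable {m n : ℕ} {A : Fin m → Fin n → ℝ} {σ τ : Finset (Fin m)} {T : Finset (Finset (Fin m))}

open Classical in
/-- An admissible triangulation refines every cell of the regular subdivision induced by `l`. -/
theorem IsTriangulation.volume_tight (hT : IsTriangulation A T) {l : Fin m → ℝ}
    (hl : ∀ σ ∈ T, Admissible A l σ) {γ : (Fin n → ℝ) →ᵃ[ℝ] ℝ} (hγ : ∀ i, l i ≤ γ (A i)) :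
    volume.real (convexHull ℝ (A '' {i | γ (A i) = l i})) =
      ∑ σ ∈ T.filter (fun σ => interp A σ l = γ), volume.real (hull A σ) := by
  rw [← measureReal_biUnion_finset₀ (fun σ hσ τ hτ hne => hT.volume_inter
    (Finset.mem_filter.1 hσ).1 (Finset.mem_filter.1 hτ).1 hne)
    (fun σ _ => (measurableSet_hull A _).nullMeasurableSet) (fun σ _ => volume_hull_ne_top A _)]
  -- A point of the tight cell lies in some simplex of `T`, where the interpolation equals `γ` at
  -- that point; if the two affine functions differ, this happens only on a null set.
  refine congrArg ENNReal.toReal (le_antisymm ?_ (measure_mono ?_))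
  · have hnull : volume (⋃ σ ∈ T.filter (fun σ => ¬ interp A σ l = γ),
        {x | interp A σ l x = γ x}) = 0 :=
      (measure_biUnion_null_iff (Finset.countable_toSet _)).2 fun τ hτ =>
        volume_setOf_affineMap_eq (Finset.mem_filter.1 hτ).2
    refine (measure_mono (t := (⋃ σ ∈ T.filter (fun σ => interp A σ l = γ), hull A σ) ∪
      ⋃ σ ∈ T.filter (fun σ => ¬ interp A σ l = γ), {x | interp A σ l x = γ x})
      fun x hx => ?_).trans ((measure_union_le _ _).trans (by rw [hnull, add_zero]))
    have hxA : x ∈ convexHull ℝ (Set.range A) := convexHull_mono (Set.image_subset_range _ _) hx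
    rw [← hT.2.1] at hxA
    obtain ⟨σ, hσ, hxσ⟩ := Set.mem_iUnion₂.1 hxA
    by_cases h : interp A σ l = γ
    · exact Or.inl (Set.mem_iUnion₂.2 ⟨σ, Finset.mem_filter.2 ⟨hσ, h⟩, hxσ⟩)
    · refine Or.inr (Set.mem_iUnion₂.2 ⟨σ, Finset.mem_filter.2 ⟨hσ, h⟩, ?_⟩)
      exact le_antisymm ((hT.isSimplex hσ).interp_le hγ hxσ)
        (affineMap_le_on_hull (fun i hi => le_of_eq_of_le hi (hl σ hσ i)) hx)
  · refine Set.iUnion₂_subset fun σ hσ => convexHull_mono (Set.image_mono fun i hi => ?_)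
    obtain ⟨hσ, h⟩ := Finset.mem_filter.1 hσ
    change γ (A i) = l i
    rw [← h, (hT.isSimplex hσ).interp_vertex l hi]

/-- The translates of the interpolation of `l` over `σ` by constants. -/
def shiftedInterp (A : Fin m → Fin n → ℝ) (l : Fin m → ℝ) (σ : Finset (Fin m)) (s : ℝ) :
    (Fin n → ℝ) →ᵃ[ℝ] ℝ :=
  interp A σ l + AffineMap.const ℝ _ s

theorem shiftedInterp_apply (l : Fin m → ℝ) (s : ℝ) (x : Fin n → ℝ) :
    shiftedInterp A l σ s x = interp A σ l x + s :=
  rfl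

theorem shiftedInterp_injective (l : Fin m → ℝ) : Function.Injective (shiftedInterp A l σ) :=
  fun s t h => by
    have := congrArg (fun f => f 0) h
    simpa [shiftedInterp_apply] using this

-- A vertical shift that makes `γ` touch the heights from above turns its maximum locus into a tight
-- cell, subdivided by the simplices whose interpolation is a translate of `γ`. Writing this with
-- indicators allows the sums over `γ` and over `σ` to be exchanged.
open Classical in
theorem IsTriangulation.latticeVol_maxLocus (hT : IsTriangulation A T) (hm : Nonempty (Fin m))
    {l : Fin m → ℝ} (hl : ∀ σ ∈ T, Admissible A l σ) (γ : (Fin n → ℝ) →ᵃ[ℝ] ℝ) :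
    latticeVol (A '' maxLocus A l γ) =
      ∑ σ ∈ T, (Set.range (shiftedInterp A l σ)).indicator
        (fun _ => latticeVol (A '' (σ : Set (Fin m)))) γ := by
  obtain ⟨k, -, hk⟩ := Finset.exists_max_image Finset.univ (fun i => l i - γ (A i))
    (Finset.univ_nonempty)
  simp only [Finset.mem_univ, true_imp_iff] at hk
  have hval : ∀ x, (γ + AffineMap.const ℝ (Fin n → ℝ) (l k - γ (A k))) x = γ x + (l k - γ (A k)) :=
    fun _ => rfl
  have hmax : maxLocus A l γ = {i | (γ + AffineMap.const ℝ (Fin n → ℝ) (l k - γ (A k))) (A i) = l i} := by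
    ext i
    rw [maxLocus, Set.mem_ofPred_eq, Set.mem_ofPred_eq, hval]
    constructor
    · intro h
      linarith [h k, hk i]
    · intro h j
      linarith [hk j]
  have hiff : ∀ σ ∈ T, γ ∈ Set.range (shiftedInterp A l σ) ↔
      interp A σ l = γ + AffineMap.const ℝ (Fin n → ℝ) (l k - γ (A k)) := fun σ hσ => by
    have hs := hT.isSimplex hσ
    constructor
    · rintro ⟨s, rfl⟩
      obtain ⟨i, hi⟩ : σ.Nonempty := Finset.card_pos.1 (by rw [hs.1]; omega)
      have h1 := hk i
      have h2 := hl σ hσ k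
      simp only [shiftedInterp_apply, hs.interp_vertex l hi] at h1
      have h3 : l k = interp A σ l (A k) := le_antisymm h2 (by linarith)
      ext x
      rw [hval]
      simp only [shiftedInterp_apply]
      linarith
    · intro h
      refine ⟨-(l k - γ (A k)), ?_⟩
      ext x
      rw [shiftedInterp_apply, h, hval]
      ring
  rw [latticeVol, hmax, hT.volume_tight hl fun i => by rw [hval]; linarith [hk i],
    Finset.sum_filter, Finset.mul_sum]
  refine Finset.sum_congr rfl fun σ hσ => ?_
  simp only [Set.indicator_apply, hiff σ hσ, latticeVol, mul_ite, mul_zero]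

/-- The vertical distances (with negative sign) between the lifted points and the hyperplane of the
lifted simplex `σ`. -/
def depth (A : Fin m → Fin n → ℝ) (l : Fin m → ℝ) (σ : Finset (Fin m)) (i : Fin m) : ℝ :=
  l i - interp A σ l (A i)

/-- The basecondary function as a sum over the simplices of an admissible triangulation. -/
theorem IsTriangulation.basecondary_eq (hT : IsTriangulation A T) (hm : Nonempty (Fin m))
    (F : Finset (Fin m) → WithBot ℝ) {l : Fin m → ℝ} (hl : ∀ σ ∈ T, Admissible A l σ) :
    basecondary A F l = ∑ σ ∈ T, latticeVol (A '' (σ : Set (Fin m))) *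
      ∑ᶠ s : ℝ, (interp A σ l 0 + s) *
        ((F (Finset.univ.filter fun i => s ≤ depth A l σ i)).unbotD 0 -
          (F (Finset.univ.filter fun i => s < depth A l σ i)).unbotD 0) := by
  classical
  set D : ((Fin n → ℝ) →ᵃ[ℝ] ℝ) → ℝ := fun γ =>
    γ 0 * ((F (nonnegLocus A l γ)).unbotD 0 - (F (posLocus A l γ)).unbotD 0) with hD
  have hDs : ∀ σ s, D (shiftedInterp A l σ s) = (interp A σ l 0 + s) *
        ((F (Finset.univ.filter fun i => s ≤ depth A l σ i)).unbotD 0 -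
          (F (Finset.univ.filter fun i => s < depth A l σ i)).unbotD 0) := fun σ s => by
    have h1 : nonnegLocus A l (shiftedInterp A l σ s) =
        Finset.univ.filter fun i => s ≤ depth A l σ i := by
      refine Finset.filter_congr fun i _ => ?_
      rw [shiftedInterp_apply, depth]
      constructor <;> intro h <;> linarith
    have h2 : posLocus A l (shiftedInterp A l σ s) =
        Finset.univ.filter fun i => s < depth A l σ i := by
      refine Finset.filter_congr fun i _ => ?_
      rw [shiftedInterp_apply, depth]
      constructor <;> intro h <;> linarith
    rw [hD]
    simp only [h1, h2, shiftedInterp_apply]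
  have hterm : ∀ γ, basecondaryTerm A F l γ = ∑ σ ∈ T, (Set.range (shiftedInterp A l σ)).indicator
      (fun γ => latticeVol (A '' (σ : Set (Fin m))) * D γ) γ := fun γ => by
    rw [basecondaryTerm, hT.latticeVol_maxLocus hm hl, Finset.mul_sum]
    refine Finset.sum_congr rfl fun σ _ => ?_
    rw [Set.indicator_apply, Set.indicator_apply, mul_ite, mul_zero, mul_comm]
  have hfin : ∀ σ ∈ T, (Function.support fun γ => (Set.range (shiftedInterp A l σ)).indicator
      (fun γ => latticeVol (A '' (σ : Set (Fin m))) * D γ) γ).Finite := fun σ _ => by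
    -- If `s` is not one of the depths, the weak and strict level sets coincide and the term
    -- vanishes.
    refine ((Set.finite_range (depth A l σ)).image (shiftedInterp A l σ)).subset fun γ hγ => ?_
    obtain ⟨⟨s, rfl⟩, h⟩ := Set.indicator_apply_ne_zero.1 hγ
    refine ⟨s, ?_, rfl⟩
    by_contra hs
    apply right_ne_zero_of_mul h
    rw [hDs, show (Finset.univ.filter fun i => s ≤ depth A l σ i) =
      Finset.univ.filter fun i => s < depth A l σ i from Finset.filter_congr fun i _ =>
        ⟨fun h => h.lt_of_ne fun h' => hs ⟨i, h'.symm⟩, le_of_lt⟩, sub_self, mul_zero]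
  rw [basecondary, finsum_congr hterm, finsum_sum_comm _ _ hfin]
  refine Finset.sum_congr rfl fun σ _ => ?_
  rw [← finsum_mem_def, finsum_mem_range (shiftedInterp_injective l), ← mul_finsum]
  · simp only [hDs]

/-- The set function obtained from `F` by adjoining `σ` to its argument. -/
def contract {m : ℕ} (F : Finset (Fin m) → WithBot ℝ) (σ S : Finset (Fin m)) : ℝ :=
  (F (S ∪ σ)).unbotD 0

/-- Every set involved contains `σ`, which has more than `n` labels, so `F` is finite there and the
restricted submodularity applies. -/
theorem contract_submodular {n : ℕ} {F : Finset (Fin m) → WithBot ℝ}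
    (hfin : ∀ I : Finset (Fin m), I = ∅ ∨ n < I.card → F I ≠ ⊥)
    (hF : ∀ I J : Finset (Fin m), n ≤ (I ∩ J).card → F (I ∩ J) + F (I ∪ J) ≤ F I + F J)
    (hσ : n < σ.card) (I J : Finset (Fin m)) :
    contract F σ (I ∩ J) + contract F σ (I ∪ J) ≤ contract F σ I + contract F σ J := by
  have hcoe : ∀ S, F (S ∪ σ) = (contract F σ S : WithBot ℝ) := fun S => by
    have := hfin (S ∪ σ) (Or.inr (hσ.trans_le (Finset.card_le_card Finset.subset_union_right)))
    obtain ⟨x, hx⟩ := WithBot.ne_bot_iff_exists.1 this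
    rw [contract, ← hx, WithBot.unbotD_coe]
  have hinter : (I ∪ σ) ∩ (J ∪ σ) = I ∩ J ∪ σ := (Finset.inter_union_distrib_right I J σ).symm
  have hunion : I ∪ σ ∪ (J ∪ σ) = I ∪ J ∪ σ := (Finset.union_union_distrib_right I J σ).symm
  have h := hF (I ∪ σ) (J ∪ σ) (by
    rw [hinter]
    exact hσ.le.trans (Finset.card_le_card Finset.subset_union_right))
  rw [hinter, hunion, hcoe, hcoe, hcoe, hcoe] at h
  exact_mod_cast h

/-- Depths vanish on `σ` and are nonpositive elsewhere, so a label of negative depth comes after all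
of `σ` in the order. Its marginal therefore involves only sets containing `σ`, where `F` and its
contraction agree. The constant `c` meets a telescoping sum. -/
theorem IsSimplex.finsum_level_eq (h : IsSimplex A σ) (F : Finset (Fin m) → WithBot ℝ)
    {l : Fin m → ℝ} (hl : Admissible A l σ) {r : Equiv.Perm (Fin m)}
    (hr : ∀ i j, depth A l σ i < depth A l σ j → r j < r i) (c : ℝ) :
    ∑ᶠ s : ℝ, (c + s) *
        ((F (Finset.univ.filter fun i => s ≤ depth A l σ i)).unbotD 0 -
          (F (Finset.univ.filter fun i => s < depth A l σ i)).unbotD 0) =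
      c * ((F Finset.univ).unbotD 0 - (F ∅).unbotD 0) +
        ∑ i, depth A l σ i * greedy (contract F σ) r i := by
  rw [finsum_mul_level_sub (fun S => (F S).unbotD 0) r.injective (depth A l σ) hr fun s => c + s]
  simp only [add_mul, Finset.sum_add_distrib, ← Finset.mul_sum]
  rw [sum_greedy_of_isLower _ r.injective _ (by simp)]
  congr 1
  refine Finset.sum_congr rfl fun i _ => ?_
  -- Marginals through small sets, where `F` may be `⊥` and the default value enters, occur only
  -- with the factor zero.
  rcases eq_or_ne (depth A l σ i) 0 with h0 | h0
  · rw [h0, zero_mul, zero_mul]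
  have hneg : depth A l σ i < 0 := h0.lt_of_le (sub_nonpos.2 (hl i))
  have hlt : ∀ k ∈ σ, r k < r i := fun k hk => hr i k (by
    rw [show depth A l σ k = 0 by rw [depth, h.interp_vertex l hk, sub_self]]
    exact hneg)
  rw [greedy, greedy, contract, contract, Finset.union_eq_left.2 fun k hk => by simp [(hlt k hk).le],
    Finset.union_eq_left.2 fun k hk => by simp [hlt k hk]]

/-- The value at `x` of the interpolation over `σ`, as a functional of the heights. -/
def interpAt (A : Fin m → Fin n → ℝ) (σ : Finset (Fin m)) (x : Fin n → ℝ) :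
    (Fin m → ℝ) →ₗ[ℝ] ℝ :=
  ∑ k ∈ σ, bary A σ k x • (LinearMap.proj k : (Fin m → ℝ) →ₗ[ℝ] ℝ)

theorem interpAt_apply (x : Fin n → ℝ) (l : Fin m → ℝ) : interpAt A σ x l = interp A σ l x := by
  simp [interpAt, interp_apply, mul_comm]

/-- The linear pieces of the contribution of the simplex `σ` to the basecondary function. -/
def piece (A : Fin m → Fin n → ℝ) (F : Finset (Fin m) → WithBot ℝ) (σ : Finset (Fin m))
    (r : Equiv.Perm (Fin m)) : (Fin m → ℝ) →ₗ[ℝ] ℝ :=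
  ((F Finset.univ).unbotD 0 - (F ∅).unbotD 0) • interpAt A σ 0 -
    ∑ i, greedy (contract F σ) r i • slack A σ i

theorem piece_apply (F : Finset (Fin m) → WithBot ℝ) (r : Equiv.Perm (Fin m)) (l : Fin m → ℝ) :
    piece A F σ r l = interp A σ l 0 * ((F Finset.univ).unbotD 0 - (F ∅).unbotD 0) +
      ∑ i, depth A l σ i * greedy (contract F σ) r i := by
  simp only [piece, LinearMap.sub_apply, LinearMap.smul_apply, LinearMap.sum_apply, smul_eq_mul,
    interpAt_apply, slack_apply, sub_eq_add_neg (_ * interp A σ l 0), ← Finset.sum_neg_distrib]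
  rw [mul_comm]
  congr 1
  refine Finset.sum_congr rfl fun i _ => ?_
  rw [depth]
  ring

/-- The linear pieces of the basecondary function over the secondary cone of `T`. -/
def pieceSum (A : Fin m → Fin n → ℝ) (F : Finset (Fin m) → WithBot ℝ)
    (T : Finset (Finset (Fin m))) (r : Finset (Fin m) → Equiv.Perm (Fin m)) :
    (Fin m → ℝ) →ₗ[ℝ] ℝ :=
  ∑ σ ∈ T, latticeVol (A '' (σ : Set (Fin m))) • piece A F σ (r σ)

theorem latticeVol_nonneg (S : Set (Fin n → ℝ)) : 0 ≤ latticeVol S :=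
  mul_nonneg (Nat.cast_nonneg _) measureReal_nonneg

/-- Over the secondary cone of a triangulation the basecondary function is a maximum of linear
functionals. -/
theorem IsTriangulation.basecondary_isMax (hT : IsTriangulation A T) (hm : Nonempty (Fin m))
    {F : Finset (Fin m) → WithBot ℝ}
    (hfin : ∀ I : Finset (Fin m), I = ∅ ∨ n < I.card → F I ≠ ⊥)
    (hF : ∀ I J : Finset (Fin m), n ≤ (I ∩ J).card → F (I ∩ J) + F (I ∪ J) ≤ F I + F J)
    {l : Fin m → ℝ} (hl : ∀ σ ∈ T, Admissible A l σ) :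
    (∀ r, pieceSum A F T r l ≤ basecondary A F l) ∧ ∃ r, pieceSum A F T r l = basecondary A F l := by
  -- The order is chosen separately for each simplex, since each one sorts its own depths.
  choose r hr using fun σ => exists_perm_sorting (depth A l σ)
  have heq : pieceSum A F T r l = basecondary A F l := by
    rw [hT.basecondary_eq hm F hl, pieceSum, LinearMap.sum_apply]
    refine Finset.sum_congr rfl fun σ hσ => ?_
    rw [(hT.isSimplex hσ).finsum_level_eq F (hl σ hσ) (hr σ), LinearMap.smul_apply, piece_apply,
      smul_eq_mul]
  refine ⟨fun r' => ?_, r, heq⟩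
  rw [← heq, pieceSum, pieceSum, LinearMap.sum_apply, LinearMap.sum_apply]
  refine Finset.sum_le_sum fun σ hσ => ?_
  rw [LinearMap.smul_apply, LinearMap.smul_apply, piece_apply, piece_apply]
  refine mul_le_mul_of_nonneg_left (add_le_add_right ?_ _) (latticeVol_nonneg _)
  exact sum_mul_greedy_le _ (contract_submodular hfin hF (by rw [(hT.isSimplex hσ).1]; omega))
    (r σ).injective (r' σ).injective _ (hr σ)

end

end Basecondary

/-! ### The support function of the secondary polytope -/

namespace Basecondary

variable {m n : ℕ} {A : Fin m → Fin n → ℝ}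

/-- The pairing with the Gelfand–Kapranov–Zelevinsky vector of `T`. -/
noncomputable def gkzFunctional (A : Fin m → Fin n → ℝ) (T : Finset (Finset (Fin m))) :
    (Fin m → ℝ) →ₗ[ℝ] ℝ :=
  ∑ i, gkzVector A T i • (LinearMap.proj i : (Fin m → ℝ) →ₗ[ℝ] ℝ)

theorem gkzFunctional_apply (T : Finset (Finset (Fin m))) (l : Fin m → ℝ) :
    gkzFunctional A T l = ∑ i, l i * gkzVector A T i := by
  simp [gkzFunctional, mul_comm]

/-- The support function of the convex hull of a set at which the pairing has a maximum. -/
theorem supportFunction_convexHull_eq {S : Set (Fin m → ℝ)} {l x : Fin m → ℝ} (hx : x ∈ S)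
    (hmax : ∀ y ∈ S, ∑ i, l i * y i ≤ ∑ i, l i * x i) :
    supportFunction (convexHull ℝ S) l = ∑ i, l i * x i := by
  refine IsGreatest.csSup_eq ⟨⟨x, subset_convexHull ℝ _ hx, rfl⟩, ?_⟩
  rintro _ ⟨y, hy, rfl⟩
  have hconv : Convex ℝ {y : Fin m → ℝ | ∑ i, l i * y i ≤ ∑ i, l i * x i} :=
    convex_halfSpace_le ⟨fun y z => by simp [mul_add, Finset.sum_add_distrib],
      fun c y => by simp [Finset.mul_sum, mul_left_comm]⟩ _
  exact convexHull_min (fun z hz => hmax z hz) hconv hy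

theorem supportFunction_secondaryPolytope {T : Finset (Finset (Fin m))} (hT : IsTriangulation A T)
    {l : Fin m → ℝ} (hmax : ∀ T', IsTriangulation A T' → gkzFunctional A T' l ≤ gkzFunctional A T l) :
    supportFunction (secondaryPolytope A) l = gkzFunctional A T l := by
  rw [gkzFunctional_apply]
  refine supportFunction_convexHull_eq ⟨T, hT, rfl⟩ ?_
  rintro _ ⟨T', hT', rfl⟩
  rw [← gkzFunctional_apply, ← gkzFunctional_apply]
  exact hmax T' hT'

theorem latticeVol_image_eq_zero (hA : affineSpan ℝ (Set.range A) ≠ ⊤) (s : Set (Fin m)) :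
    latticeVol (A '' s) = 0 := by
  by_contra h
  have := affineSpan_eq_top_of_latticeVol_ne_zero h
  exact hA (top_le_iff.1 (this ▸ affineSpan_mono ℝ (Set.image_subset_range A s)))

theorem supportFunction_eq_zero (hA : affineSpan ℝ (Set.range A) ≠ ⊤) (l : Fin m → ℝ) :
    supportFunction (secondaryPolytope A) l = 0 := by
  -- Without triangulations the supremum is `sSup ∅ = 0`; otherwise all GKZ vectors vanish because
  -- all volumes do. The latter covers `m = 0`, where the empty triangulation exists.
  rcases Set.eq_empty_or_nonempty {φ | ∃ T, IsTriangulation A T ∧ gkzVector A T = φ} with h | h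
  · simp [supportFunction, secondaryPolytope, h]
  · have hzero : ∀ φ ∈ {φ | ∃ T, IsTriangulation A T ∧ gkzVector A T = φ}, φ = 0 := by
      rintro _ ⟨T, -, rfl⟩
      ext i
      exact Finset.sum_eq_zero fun σ _ => latticeVol_image_eq_zero hA _
    obtain ⟨φ, hφ⟩ := h
    rw [secondaryPolytope, supportFunction_convexHull_eq hφ fun y hy => by
      rw [hzero y hy, hzero φ hφ], hzero φ hφ]
    simp

theorem basecondary_eq_zero (hA : affineSpan ℝ (Set.range A) ≠ ⊤)
    (F : Finset (Fin m) → WithBot ℝ) (l : Fin m → ℝ) : basecondary A F l = 0 := by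
  simp [basecondary, basecondaryTerm, latticeVol_image_eq_zero hA]

end Basecondary

/-! ### Proof of the theorem -/

theorem theorem1p2 {m n : ℕ} (A : Fin m → Fin n → ℝ) (F : Finset (Fin m) → WithBot ℝ)
    (hfin : ∀ I : Finset (Fin m), I = ∅ ∨ n < I.card → F I ≠ ⊥)
    (hF : ∀ I J : Finset (Fin m), n ≤ (I ∩ J).card → F (I ∩ J) + F (I ∪ J) ≤ F I + F J) :
    ∃ c₀ : ℝ, ∀ c : ℝ, c₀ ≤ c →
      ConvexOn ℝ Set.univ (fun l : Fin m → ℝ =>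
        Basecondary.basecondary A F l +
          c * Basecondary.supportFunction (Basecondary.secondaryPolytope A) l) := by
  classical
  by_cases hA : affineSpan ℝ (Set.range A) = ⊤
  · have hm : Nonempty (Fin m) := by
      rw [← Set.range_nonempty_iff_nonempty (f := A), ← affineSpan_nonempty ℝ, hA]
      exact ⟨0, trivial⟩
    have hmax : ∀ l : Fin m → ℝ, ∃ T, Basecondary.IsTriangulation A T ∧
        ∀ T', Basecondary.IsTriangulation A T' →
          Basecondary.gkzFunctional A T' l ≤ Basecondary.gkzFunctional A T l := fun l => by
      obtain ⟨T₀, hT₀, -⟩ := Basecondary.exists_admissible_triangulation hA l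
      exact Set.exists_max_image {T | Basecondary.IsTriangulation A T}
        (fun T => Basecondary.gkzFunctional A T l) (Set.toFinite _) ⟨T₀, hT₀⟩
    have hle : ∀ l T, Basecondary.IsTriangulation A T → Basecondary.gkzFunctional A T l ≤
        Basecondary.supportFunction (Basecondary.secondaryPolytope A) l := fun l T hT => by
      obtain ⟨T', hT', h⟩ := hmax l
      rw [Basecondary.supportFunction_secondaryPolytope hT' h]
      exact h T hT
    have hadm : ∀ l T, Basecondary.IsTriangulation A T → Basecondary.gkzFunctional A T l =
        Basecondary.supportFunction (Basecondary.secondaryPolytope A) l →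
        ∀ σ ∈ T, Basecondary.Admissible A l σ := fun l T hT h => by
      obtain ⟨T', hT', hT'l⟩ := Basecondary.exists_admissible_triangulation hA l
      refine hT.admissible_of_le hT' hT'l ?_
      rw [← Basecondary.gkzFunctional_apply, ← Basecondary.gkzFunctional_apply, h]
      exact hle l T' hT'
    -- The cones are indexed by triangulations, and the linear pieces on each by a choice of an
    -- order for every simplex; both families are finite.
    exact Basecondary.exists_convexOn_add_mul
      (τ := {T // Basecondary.IsTriangulation A T})
      (ρ := Finset (Fin m) → Equiv.Perm (Fin m))
      (fun T => Basecondary.gkzFunctional A T.1) (fun T r => Basecondary.pieceSum A F T.1 r) _ _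
      (fun l T => hle l T.1 T.2)
      (fun l => by
        obtain ⟨T, hT, h⟩ := hmax l
        exact ⟨⟨T, hT⟩, (Basecondary.supportFunction_secondaryPolytope hT h).symm⟩)
      (fun l T h => (T.2.basecondary_isMax hm hfin hF (hadm l T.1 T.2 h)).1)
      (fun l T h => (T.2.basecondary_isMax hm hfin hF (hadm l T.1 T.2 h)).2)
  · refine ⟨0, fun c _ => ?_⟩
    simp only [Basecondary.basecondary_eq_zero hA, Basecondary.supportFunction_eq_zero hA, mul_zero,
      add_zero]
    exact convexOn_const 0 convex_univ
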